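/- All graphs are finite, simple and undirected. A matching $M$ in a graph $G$ is acyclic if the subgraph of $G$ induced by the set of vertices incident to some edge of $M$ is a forest, and the acyclic matching number $\nu_{ac}(G)$ is the maximum size of an acyclic matching in $G$. For graphs $G$ and $H$, let $\kappa_G(H)$ denote the number of components of $G$ that are isomorphic to $H$, and let $K_4^+$ be the graph obtained from $K_4$ by subdividing one edge once. Let $G$ be a subcubic graph (that is, every vertex has degree at most $3$) without isolated vertices, and let $n(G)$ be its number of vertices. Then $$\nu_{ac}(G) \ \geq\ \frac{1}{4}\Bigl( n(G) - \kappa_G(K_{2,3}) - \kappa_G(K_4^+) - 2\,\kappa_G(K_{3,3}) \Bigr).$$ -/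

import Mathlib

namespace SimpleGraph

/-- A matching `M` of `G` is acyclic if the subgraph of `G` induced by the set of vertices incident
to some edge of `M` is a forest. (For a matching, `M.verts` is exactly that set.) -/
def IsAcyclicMatching {V : Type*} {G : SimpleGraph V} (M : G.Subgraph) : Prop :=
  M.IsMatching ∧ (G.induce M.verts).IsAcyclic

/-- The acyclic matching number of a finite graph: the maximum number of edges of an acyclic
matching. -/
noncomputable def acyclicMatchingNumber {V : Type*} [Finite V] (G : SimpleGraph V) : ℕ :=
  sSup {k : ℕ | ∃ M : G.Subgraph, IsAcyclicMatching M ∧ M.edgeSet.ncard = k}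

/-- On a finite graph the supremum is attained, so it is a maximum. -/
theorem isGreatest_acyclicMatchingNumber {V : Type*} [Finite V] (G : SimpleGraph V) :
    IsGreatest {k : ℕ | ∃ M : G.Subgraph, IsAcyclicMatching M ∧ M.edgeSet.ncard = k}
      G.acyclicMatchingNumber := by
  have hb : BddAbove {k : ℕ | ∃ M : G.Subgraph, IsAcyclicMatching M ∧ M.edgeSet.ncard = k} := by
    refine ⟨G.edgeSet.ncard, ?_⟩
    rintro k ⟨M, -, rfl⟩
    exact Set.ncard_le_ncard M.edgeSet_subset (Set.toFinite _)
  have hne : {k : ℕ | ∃ M : G.Subgraph, IsAcyclicMatching M ∧ M.edgeSet.ncard = k}.Nonempty := by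
    refine ⟨_, ⊥, ⟨fun v hv => absurd hv (by simp), fun v => (Set.notMem_empty _ v.2).elim⟩, rfl⟩
  exact ⟨Nat.sSup_mem hne hb, fun k hk => le_csSup hb hk⟩

/-- The number of connected components of `G` that are isomorphic to `H`. -/
noncomputable def componentCount {V W : Type*} (G : SimpleGraph V) (H : SimpleGraph W) : ℕ :=
  {c : G.ConnectedComponent | Nonempty (c.toSimpleGraph ≃g H)}.ncard

/-- The graph obtained from `G` by subdividing the edge `u v` once: that edge is removed, and a new
vertex `none` adjacent to exactly `u` and `v` is added. -/
def subdivideEdge {V : Type*} (G : SimpleGraph V) (u v : V) : SimpleGraph (Option V) where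
  Adj
    | some a, some b => G.Adj a b ∧ s(a, b) ≠ s(u, v)
    | some a, none => a = u ∨ a = v
    | none, some b => b = u ∨ b = v
    | none, none => False
  symm := ⟨by
    rintro (_ | a) (_ | b) h
    · exact h
    · exact h
    · exact h
    · exact ⟨h.1.symm, by rw [Sym2.eq_swap]; exact h.2⟩⟩
  loopless := ⟨by
    rintro (_ | a) h
    · exact h
    · exact G.loopless.irrefl a h.1⟩

/-- `K₄⁺`: the complete graph on four vertices with one edge subdivided once. -/
def K4Plus : SimpleGraph (Option (Fin 4)) :=
  subdivideEdge (⊤ : SimpleGraph (Fin 4)) 0 1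

end SimpleGraph

/-! An acyclic matching amounts to a vertex set `S` that induces a forest and has a perfect
matching; its size is `|S| / 2`. So it suffices to find `S` with `n ≤ 2|S|` plus the losses of the
exceptional components. This is proved for every finite vertex set by strong induction
(`hasLargeMatching`). Deleting vertices may isolate others, so single vertices count as exceptional
with loss 1; the hypothesis on isolated vertices enters only at the very end.

Let `W` be connected and not exceptional. Take an induced tree `T` with a perfect matching, let `B`
be the set of outside vertices with a neighbour in `T`, and `C` the rest. If no pendant path of
length two can be attached to `T`, a vertex of `B` with `d` neighbours in `T` has at most `d - 1` in
`C`. Counting the edges between `T` and `B` from both sides gives `|W| = 2|T| + |C| + 2 - deficit -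
slack - crossing` (`IsStuck.sum_eq`). An exceptional component of `C` sends an edge to `B`, and the
cubic `K₃,₃` has none to send, so the losses in `C` are at most `crossing`. One further unit is free
for even `|W|`, because `2|S|` is even. Hence two units from deficit, slack and parity suffice
(`IsStuck.isReducible_of_two_le`).

One unit is always at hand: parity, or for odd `|W|` a vertex of degree at most two placed in `T`.
For the second, vertices of degree at most one, `K₄⁺`, and `K₂,₃` with a low vertex are treated
separately. Without them, a nonempty `C` gives the missing unit (`IsExceptionalFamily.sum_loss_lt`).
If `C` is empty and there is no slack, maximality of `T` forces a `K₂,₃` at a matching edge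
(`IsMaxMatchedTree.exists_isK23Pattern`), and a tree regrown through it has slack. -/

namespace SimpleGraph

/-! ### Degrees into finite sets, forests, matings and matched trees -/

section
variable {V : Type*} {G : SimpleGraph V}

open Classical in
/-- The neighbours of `v` inside the finite set `U`. -/
noncomputable def nbrIn (G : SimpleGraph V) (U : Finset V) (v : V) : Finset V :=
  U.filter (G.Adj v)

@[simp] lemma mem_nbrIn {U : Finset V} {u v : V} : u ∈ G.nbrIn U v ↔ u ∈ U ∧ G.Adj v u := by
  simp [nbrIn]

/-- The number of neighbours of `v` inside the finite set `U`. -/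
noncomputable def degIn (G : SimpleGraph V) (U : Finset V) (v : V) : ℕ := (G.nbrIn U v).card

lemma degIn_mono {U U' : Finset V} (h : U ⊆ U') (v : V) : G.degIn U v ≤ G.degIn U' v :=
  Finset.card_le_card fun u hu => by
    rw [mem_nbrIn] at hu ⊢
    exact ⟨h hu.1, hu.2⟩

lemma degIn_le_of_forall {U U' : Finset V} {v : V} (h : ∀ u ∈ U, G.Adj v u → u ∈ U') :
    G.degIn U v ≤ G.degIn U' v :=
  Finset.card_le_card fun u hu => by
    rw [mem_nbrIn] at hu ⊢
    exact ⟨h u hu.1 hu.2, hu.2⟩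

lemma degIn_pos {U : Finset V} {v : V} : 0 < G.degIn U v ↔ ∃ u ∈ U, G.Adj v u := by
  simp [degIn, Finset.card_pos, Finset.Nonempty]

lemma degIn_eq_zero {U : Finset V} {v : V} : G.degIn U v = 0 ↔ ∀ u ∈ U, ¬ G.Adj v u := by
  have := degIn_pos (G := G) (U := U) (v := v)
  grind

lemma degIn_eq_one {U : Finset V} {v : V} :
    G.degIn U v = 1 ↔ ∃ a ∈ U, G.Adj v a ∧ ∀ u ∈ U, G.Adj v u → u = a := by
  rw [degIn, Finset.card_eq_one]
  constructor
  · rintro ⟨a, ha⟩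
    have h1 : a ∈ G.nbrIn U v := by simp [ha]
    rw [mem_nbrIn] at h1
    refine ⟨a, h1.1, h1.2, fun u hu huv => ?_⟩
    have h2 : u ∈ G.nbrIn U v := by simp [hu, huv]
    simpa [ha] using h2
  · rintro ⟨a, ha, hva, h⟩
    refine ⟨a, ?_⟩
    ext u
    simp only [mem_nbrIn, Finset.mem_singleton]
    constructor
    · rintro ⟨h1, h2⟩
      exact h u h1 h2
    · rintro rfl
      exact ⟨ha, hva⟩

lemma two_le_degIn {U : Finset V} {v : V} :
    2 ≤ G.degIn U v ↔ ∃ a ∈ U, ∃ b ∈ U, a ≠ b ∧ G.Adj v a ∧ G.Adj v b := by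
  rw [degIn, ← Nat.lt_iff_add_one_le, Finset.one_lt_card]
  simp only [mem_nbrIn]
  grind

variable [DecidableEq V]

lemma three_le_degIn {U : Finset V} {v a b c : V} (ha : a ∈ U) (hb : b ∈ U) (hc : c ∈ U)
    (hab : a ≠ b) (hac : a ≠ c) (hbc : b ≠ c) (hva : G.Adj v a) (hvb : G.Adj v b)
    (hvc : G.Adj v c) : 3 ≤ G.degIn U v := by
  rw [← Finset.card_eq_three.2 ⟨a, b, c, hab, hac, hbc, rfl⟩]
  refine Finset.card_le_card fun u hu => ?_
  simp only [Finset.mem_insert, Finset.mem_singleton] at hu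
  rw [mem_nbrIn]
  rcases hu with rfl | rfl | rfl <;> exact ⟨by assumption, by assumption⟩

lemma exists_of_two_lt_degIn {U : Finset V} {v : V} (h : 2 < G.degIn U v) (a b : V) :
    ∃ c ∈ U, G.Adj v c ∧ c ≠ a ∧ c ≠ b := by
  by_contra! hc
  have : G.nbrIn U v ⊆ {a, b} := by
    intro u hu
    rw [mem_nbrIn] at hu
    have := hc u hu.1 hu.2
    simp only [Finset.mem_insert, Finset.mem_singleton]
    tauto
  have h1 := Finset.card_le_card this
  have h2 := Finset.card_le_two (a := a) (b := b)
  unfold degIn at h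
  omega

lemma eq_of_adj_of_degIn_le_three {U : Finset V} {v a b c u : V} (h : G.degIn U v ≤ 3)
    (ha : a ∈ U) (hb : b ∈ U) (hc : c ∈ U) (hab : a ≠ b) (hac : a ≠ c) (hbc : b ≠ c)
    (hva : G.Adj v a) (hvb : G.Adj v b) (hvc : G.Adj v c) (hu : u ∈ U) (hvu : G.Adj v u) :
    u = a ∨ u = b ∨ u = c := by
  by_contra! hne
  have hsub : ({u, a, b, c} : Finset V) ⊆ G.nbrIn U v := by
    intro w hw
    simp only [Finset.mem_insert, Finset.mem_singleton] at hw
    rw [mem_nbrIn]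
    rcases hw with rfl | rfl | rfl | rfl <;> exact ⟨by assumption, by assumption⟩
  have hcard : ({u, a, b, c} : Finset V).card = 4 := by
    rw [Finset.card_insert_of_notMem (by simp [hne]),
      Finset.card_eq_three.2 ⟨a, b, c, hab, hac, hbc, rfl⟩]
  have := Finset.card_le_card hsub
  unfold degIn at h
  omega

lemma eq_of_adj_of_degIn_le_two {U : Finset V} {v a b u : V} (h : G.degIn U v ≤ 2)
    (ha : a ∈ U) (hb : b ∈ U) (hab : a ≠ b)
    (hva : G.Adj v a) (hvb : G.Adj v b) (hu : u ∈ U) (hvu : G.Adj v u) : u = a ∨ u = b := by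
  by_contra! hne
  have := three_le_degIn hu ha hb hne.1 hne.2 hab hvu hva hvb
  omega

lemma degIn_union {A B : Finset V} (h : Disjoint A B) (v : V) :
    G.degIn (A ∪ B) v = G.degIn A v + G.degIn B v := by
  unfold degIn
  rw [← Finset.card_union_of_disjoint]
  · congr 1
    ext u
    simp only [mem_nbrIn, Finset.mem_union]
    tauto
  · rw [Finset.disjoint_left] at h ⊢
    intro u h1 h2
    rw [mem_nbrIn] at h1 h2
    exact h h1.1 h2.1

open Classical in
lemma degIn_insert {U : Finset V} {v : V} (h : v ∉ U) (u : V) :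
    G.degIn (insert v U) u = G.degIn U u + if G.Adj u v then 1 else 0 := by
  rw [Finset.insert_eq, degIn_union (by simpa using h), add_comm]
  congr 1
  unfold degIn nbrIn
  rw [Finset.filter_singleton]
  split_ifs <;> simp

omit [DecidableEq V] in
lemma sum_degIn_comm (A B : Finset V) :
    ∑ a ∈ A, G.degIn B a = ∑ b ∈ B, G.degIn A b := by
  classical
  unfold degIn nbrIn
  simp only [Finset.card_filter]
  rw [Finset.sum_comm]
  simp only [G.adj_comm]

lemma sum_degIn_insert {U : Finset V} {v : V} (h : v ∉ U) :
    ∑ u ∈ insert v U, G.degIn (insert v U) u = ∑ u ∈ U, G.degIn U u + 2 * G.degIn U v := by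
  classical
  rw [Finset.sum_insert h]
  simp only [degIn_insert h, Finset.sum_add_distrib, SimpleGraph.irrefl, if_false]
  have : ∑ u ∈ U, (if G.Adj u v then 1 else 0) = G.degIn U v := by
    unfold degIn nbrIn
    rw [Finset.card_filter]
    simp only [G.adj_comm]
  omega

/-- The finite vertex set `U` induces a forest: each nonempty subset has a vertex with at most one
neighbour in it. -/
def IsForestOn (G : SimpleGraph V) (U : Finset V) : Prop :=
  ∀ A ⊆ U, A.Nonempty → ∃ v ∈ A, G.degIn A v ≤ 1

omit [DecidableEq V] in
lemma IsForestOn.mono {A U : Finset V} (h : G.IsForestOn U) (hA : A ⊆ U) : G.IsForestOn A :=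
  fun X hX => h X (hX.trans hA)

lemma IsForestOn.insert {U : Finset V} (h : G.IsForestOn U) {v : V} (hv : G.degIn U v ≤ 1) :
    G.IsForestOn (insert v U) := by
  intro A hA hne
  by_cases hvA : v ∈ A
  · refine ⟨v, hvA, le_trans (degIn_le_of_forall fun u hu huv => ?_) hv⟩
    rcases Finset.mem_insert.1 (hA hu) with rfl | h1
    · exact absurd huv (G.irrefl)
    · exact h1
  · exact h A ((Finset.subset_insert_iff_of_notMem hvA).1 hA) hne

lemma IsForestOn.union {A B : Finset V} (hA : G.IsForestOn A) (hB : G.IsForestOn B)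
    (h : ∀ a ∈ A, ∀ b ∈ B, ¬ G.Adj a b) : G.IsForestOn (A ∪ B) := by
  intro X hX hne
  by_cases hXA : (X ∩ A).Nonempty
  · obtain ⟨v, hv, hd⟩ := hA (X ∩ A) Finset.inter_subset_right hXA
    rw [Finset.mem_inter] at hv
    refine ⟨v, hv.1, le_trans (degIn_le_of_forall fun u hu huv => ?_) hd⟩
    rcases Finset.mem_union.1 (hX hu) with h1 | h1
    · exact Finset.mem_inter.2 ⟨hu, h1⟩
    · exact absurd huv (h v hv.2 u h1)
  · refine hB X (fun u hu => ?_) hne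
    rcases Finset.mem_union.1 (hX hu) with h1 | h1
    · exact absurd ⟨u, Finset.mem_inter.2 ⟨hu, h1⟩⟩ hXA
    · exact h1

/-- A forest contains no four-cycle. -/
lemma IsForestOn.not_four_cycle {U : Finset V} (h : G.IsForestOn U) {a b c d : V}
    (ha : a ∈ U) (hb : b ∈ U) (hc : c ∈ U) (hac : a ≠ c) (hbd : b ≠ d)
    (h1 : G.Adj a b) (h2 : G.Adj b c) (h3 : G.Adj c d) (h4 : G.Adj d a) : d ∉ U := by
  intro hd
  obtain ⟨v, hv, hle⟩ := h {a, b, c, d} (by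
    intro u hu
    simp only [Finset.mem_insert, Finset.mem_singleton] at hu
    rcases hu with rfl | rfl | rfl | rfl <;> assumption) ⟨a, by simp⟩
  have : 2 ≤ G.degIn {a, b, c, d} v := by
    rw [two_le_degIn]
    simp only [Finset.mem_insert, Finset.mem_singleton] at hv
    rcases hv with rfl | rfl | rfl | rfl
    · exact ⟨b, by simp, d, by simp, hbd, h1, h4.symm⟩
    · exact ⟨a, by simp, c, by simp, hac, h1.symm, h2⟩
    · exact ⟨b, by simp, d, by simp, hbd, h2.symm, h3⟩
    · exact ⟨a, by simp, c, by simp, hac, h4, h3.symm⟩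
  omega

/-- The involution `f` restricts to a perfect matching of the subgraph induced by `T`. -/
def IsMating (G : SimpleGraph V) (f : V → V) (T : Finset V) : Prop :=
  ∀ v ∈ T, f v ∈ T ∧ G.Adj v (f v) ∧ f (f v) = v

/-- The subgraph induced by `T` has a perfect matching. -/
def HasMating (G : SimpleGraph V) (T : Finset V) : Prop := ∃ f, G.IsMating f T

omit [DecidableEq V] in
lemma hasMating_empty : G.HasMating ∅ := ⟨id, by simp [IsMating]⟩

lemma hasMating_pair {a b : V} (h : G.Adj a b) : G.HasMating {a, b} := by
  refine ⟨Equiv.swap a b, fun v hv => ?_⟩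
  simp only [Finset.mem_insert, Finset.mem_singleton] at hv
  rcases hv with rfl | rfl
  · simp [h]
  · simp [h.symm]

lemma HasMating.union {A B : Finset V} (hA : G.HasMating A) (hB : G.HasMating B)
    (h : Disjoint A B) : G.HasMating (A ∪ B) := by
  obtain ⟨f, hf⟩ := hA
  obtain ⟨g, hg⟩ := hB
  refine ⟨fun v => if v ∈ A then f v else g v, fun v hv => ?_⟩
  by_cases hvA : v ∈ A
  · obtain ⟨h1, h2, h3⟩ := hf v hvA
    simp [hvA, h1, h2, h3]
  · have hvB : v ∈ B := (Finset.mem_union.1 hv).resolve_left hvA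
    obtain ⟨h1, h2, h3⟩ := hg v hvB
    simp [hvA, h1, h2, h3, Finset.disjoint_right.1 h h1]

lemma HasMating.insert_insert {A : Finset V} (hA : G.HasMating A) {a b : V} (ha : a ∉ A)
    (hb : b ∉ A) (h : G.Adj a b) : G.HasMating (insert a (insert b A)) := by
  have := (hasMating_pair h).union hA (by simp [ha, hb])
  simpa [Finset.insert_union] using this

lemma IsMating.sdiff_pair {f : V → V} {T : Finset V} (h : G.IsMating f T) {v : V} (hv : v ∈ T) :
    G.IsMating f (T \ {v, f v}) := by
  intro u hu
  simp only [Finset.mem_sdiff, Finset.mem_insert, Finset.mem_singleton, not_or] at hu ⊢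
  obtain ⟨h1, h2, h3⟩ := h u hu.1
  obtain ⟨h1', h2', h3'⟩ := h v hv
  refine ⟨⟨h1, fun h4 => hu.2.2 ?_, fun h4 => hu.2.1 ?_⟩, h2, h3⟩
  · rw [← h4, h3]
  · rw [← h3, h4, h3']

/-- `T` induces a tree: a forest with `|T| - 1` edges. -/
structure IsTreeOn (G : SimpleGraph V) (T : Finset V) : Prop where
  forest : G.IsForestOn T
  sum_degIn : ∑ v ∈ T, G.degIn T v + 2 = 2 * T.card

omit [DecidableEq V] in
lemma isTreeOn_singleton (v : V) : G.IsTreeOn {v} := by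
  have h : G.degIn {v} v = 0 := by simp [degIn_eq_zero]
  refine ⟨fun A hA hne => ?_, by simp [h]⟩
  rw [(Finset.subset_singleton_iff.1 hA).resolve_left hne.ne_empty]
  exact ⟨v, by simp, by omega⟩

lemma IsTreeOn.insert {T : Finset V} (h : G.IsTreeOn T) {v : V} (hv : v ∉ T)
    (hd : G.degIn T v = 1) : G.IsTreeOn (insert v T) := by
  refine ⟨h.forest.insert hd.le, ?_⟩
  rw [sum_degIn_insert hv, Finset.card_insert_of_notMem hv, hd]
  have := h.sum_degIn
  omega

lemma IsTreeOn.erase {T : Finset V} (h : G.IsTreeOn T) {v : V} (hv : v ∈ T)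
    (hd : G.degIn T v = 1) : G.IsTreeOn (T.erase v) := by
  refine ⟨h.forest.mono (Finset.erase_subset _ _), ?_⟩
  have h1 := sum_degIn_insert (G := G) (Finset.notMem_erase v T)
  have h2 : G.degIn (T.erase v) v = 1 := by
    rw [← hd]
    refine le_antisymm (degIn_mono (Finset.erase_subset _ _) v) (degIn_le_of_forall ?_)
    intro u hu huv
    exact Finset.mem_erase.2 ⟨huv.ne', hu⟩
  rw [Finset.insert_erase hv, h2] at h1
  have h3 := h.sum_degIn
  have h4 := Finset.card_erase_add_one hv
  omega

/-- `T` induces a tree with a perfect matching. -/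
structure IsMatchedTree (G : SimpleGraph V) (T : Finset V) : Prop extends G.IsTreeOn T where
  mating : G.HasMating T

lemma isMatchedTree_pair {a b : V} (h : G.Adj a b) : G.IsMatchedTree {a, b} :=
  ⟨(isTreeOn_singleton b).insert (by simpa using h.ne)
    (degIn_eq_one.2 ⟨b, by simp, h, by simp⟩), hasMating_pair h⟩

/-- Attaching a pendant path of length two to a matched tree. -/
lemma IsMatchedTree.insert_insert {T : Finset V} (h : G.IsMatchedTree T) {b x : V} (hb : b ∉ T)
    (hbT : G.degIn T b = 1) (hx : x ∉ T) (hxT : G.degIn T x = 0) (hbx : G.Adj x b) :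
    G.IsMatchedTree (insert x (insert b T)) := by
  refine ⟨(h.toIsTreeOn.insert hb hbT).insert (by simp [hx, hbx.ne]) ?_,
    h.mating.insert_insert hx hb hbx⟩
  rw [degIn_eq_zero] at hxT
  rw [degIn_eq_one]
  refine ⟨b, by simp, hbx, fun u hu hxu => ?_⟩
  rcases Finset.mem_insert.1 hu with h1 | h1
  · exact h1
  · exact absurd hxu (hxT u h1)

end
-- Exceptional graphs, stuck trees and the edge count
section
variable {V : Type*} {G : SimpleGraph V}

/-- `x` and `y` are common neighbours of `p`, `q` and `r`. -/
structure IsK23Pattern (G : SimpleGraph V) (x y p q r : V) : Prop where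
  ne_xy : x ≠ y
  ne_pq : p ≠ q
  ne_pr : p ≠ r
  ne_qr : q ≠ r
  xp : G.Adj x p
  xq : G.Adj x q
  xr : G.Adj x r
  yp : G.Adj y p
  yq : G.Adj y q
  yr : G.Adj y r

/-- `c d` is an edge, `a` and `b` are common neighbours of `c` and `d`, and `s` is a further common
neighbour of `a` and `b`. -/
structure IsK4PlusPattern (G : SimpleGraph V) (a b c d s : V) : Prop where
  ne_ab : a ≠ b
  ne_sc : s ≠ c
  ne_sd : s ≠ d
  cd : G.Adj c d
  ac : G.Adj a c
  ad : G.Adj a d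
  bc : G.Adj b c
  bd : G.Adj b d
  sa : G.Adj s a
  sb : G.Adj s b

/-- `x`, `y`, `z` are common neighbours of `p`, `q` and `r`. -/
structure IsK33Pattern (G : SimpleGraph V) (x y z p q r : V) : Prop extends
    IsK23Pattern G x y p q r where
  ne_xz : x ≠ z
  ne_yz : y ≠ z
  zp : G.Adj z p
  zq : G.Adj z q
  zr : G.Adj z r

variable [DecidableEq V]

/-- `X` induces a copy of `K₂,₃`. -/
def InducesK23 (G : SimpleGraph V) (X : Finset V) : Prop :=
  ∃ x y p q r, G.IsK23Pattern x y p q r ∧ X = {x, y, p, q, r} ∧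
    ¬ G.Adj x y ∧ ¬ G.Adj p q ∧ ¬ G.Adj p r ∧ ¬ G.Adj q r

/-- `X` induces a copy of `K₄⁺`. -/
def InducesK4Plus (G : SimpleGraph V) (X : Finset V) : Prop :=
  ∃ a b c d s, G.IsK4PlusPattern a b c d s ∧ X = {a, b, c, d, s} ∧
    ¬ G.Adj a b ∧ ¬ G.Adj s c ∧ ¬ G.Adj s d

/-- `X` induces a copy of `K₃,₃`. -/
def InducesK33 (G : SimpleGraph V) (X : Finset V) : Prop :=
  ∃ x y z p q r, G.IsK33Pattern x y z p q r ∧ X = {x, y, z, p, q, r} ∧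
    ¬ G.Adj x y ∧ ¬ G.Adj x z ∧ ¬ G.Adj y z ∧ ¬ G.Adj p q ∧ ¬ G.Adj p r ∧ ¬ G.Adj q r

/-- `X` is a single vertex or induces one of the three exceptional graphs. -/
def IsExceptional (G : SimpleGraph V) (X : Finset V) : Prop :=
  (∃ v, X = {v}) ∨ G.InducesK23 X ∨ G.InducesK4Plus X ∨ G.InducesK33 X

open Classical in
/-- The loss caused by an exceptional component. -/
noncomputable def loss (G : SimpleGraph V) (X : Finset V) : ℕ := if G.InducesK33 X then 2 else 1

/-- A family of pairwise disjoint exceptional subsets of `C`, each a union of components of the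
subgraph induced by `C`. -/
structure IsExceptionalFamily (G : SimpleGraph V) (C : Finset V) (𝒳 : Finset (Finset V)) :
    Prop where
  subset : ∀ X ∈ 𝒳, X ⊆ C
  exceptional : ∀ X ∈ 𝒳, G.IsExceptional X
  closed : ∀ X ∈ 𝒳, ∀ x ∈ X, ∀ y ∈ C, G.Adj x y → y ∈ X
  disjoint : ∀ X ∈ 𝒳, ∀ Y ∈ 𝒳, X ≠ Y → Disjoint X Y

/-- A partial acyclic matching on `T` together with a set `C` of remaining vertices, not joined to
`T`, such that solving `C` optimally up to exceptional components solves `W`. The summand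
`1 - W.card % 2` accounts for the parity of `2 * |T|`. -/
def IsReducible (G : SimpleGraph V) (W : Finset V) : Prop :=
  ∃ T ⊆ W, T.Nonempty ∧ G.IsForestOn T ∧ G.HasMating T ∧ ∃ C ⊆ W, Disjoint T C ∧
    (∀ t ∈ T, ∀ c ∈ C, ¬ G.Adj t c) ∧ ∀ 𝒳, G.IsExceptionalFamily C 𝒳 →
      W.card + ∑ X ∈ 𝒳, G.loss X ≤ 2 * T.card + C.card + (1 - W.card % 2)

/-- All edges of `G` lie in `W`, where `G` is connected, subcubic and not exceptional. -/
structure IsUnexceptional (G : SimpleGraph V) (W : Finset V) : Prop where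
  mem : ∀ ⦃a b⦄, G.Adj a b → b ∈ W
  degIn_le : ∀ v, G.degIn W v ≤ 3
  conn : ∀ X ⊆ W, X.Nonempty → (∀ x ∈ X, ∀ y, G.Adj x y → y ∈ X) → X = W
  nonempty : W.Nonempty
  not_exceptional : ¬ G.IsExceptional W

open Classical in
/-- The vertices of `W` outside `T` with a neighbour in `T`. -/
noncomputable def boundary (G : SimpleGraph V) (W T : Finset V) : Finset V :=
  W.filter fun v => v ∉ T ∧ 0 < G.degIn T v

open Classical in
/-- The vertices of `W` outside `T` without a neighbour in `T`. -/
noncomputable def far (G : SimpleGraph V) (W T : Finset V) : Finset V :=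
  W.filter fun v => v ∉ T ∧ G.degIn T v = 0

@[simp] lemma mem_boundary {W T : Finset V} {v : V} :
    v ∈ G.boundary W T ↔ v ∈ W ∧ v ∉ T ∧ 0 < G.degIn T v := by simp [boundary]

@[simp] lemma mem_far {W T : Finset V} {v : V} :
    v ∈ G.far W T ↔ v ∈ W ∧ v ∉ T ∧ G.degIn T v = 0 := by simp [far]

lemma disjoint_boundary_far (W T : Finset V) : Disjoint (G.boundary W T) (G.far W T) := by
  rw [Finset.disjoint_left]
  intro v h1 h2
  rw [mem_boundary] at h1
  rw [mem_far] at h2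
  omega

lemma disjoint_boundary (W T : Finset V) : Disjoint T (G.boundary W T) := by
  rw [Finset.disjoint_left]
  intro v h1 h2
  rw [mem_boundary] at h2
  exact h2.2.1 h1

lemma disjoint_far (W T : Finset V) : Disjoint T (G.far W T) := by
  rw [Finset.disjoint_left]
  intro v h1 h2
  rw [mem_far] at h2
  exact h2.2.1 h1

lemma union_boundary_far {W T : Finset V} (h : T ⊆ W) :
    T ∪ (G.boundary W T ∪ G.far W T) = W := by
  ext v
  simp only [Finset.mem_union, mem_boundary, mem_far]
  have := @h v
  by_cases h1 : v ∈ T <;> simp [h1]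
  · exact this h1
  · rw [← and_or_left]
    simp only [and_iff_left_iff_imp]
    omega

lemma disjoint_boundary_union_far (W T : Finset V) :
    Disjoint T (G.boundary W T ∪ G.far W T) :=
  Finset.disjoint_union_right.2 ⟨disjoint_boundary W T, disjoint_far W T⟩

lemma degIn_eq_sum_parts {W T : Finset V} (h : T ⊆ W) (v : V) :
    G.degIn W v = G.degIn T v + G.degIn (G.boundary W T) v + G.degIn (G.far W T) v := by
  conv_lhs => rw [← union_boundary_far (G := G) h]
  rw [degIn_union (disjoint_boundary_union_far W T), degIn_union (disjoint_boundary_far W T)]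
  ring

lemma degIn_far_eq_zero_of_mem {W T : Finset V} {v : V} (h : v ∈ T) :
    G.degIn (G.far W T) v = 0 := by
  rw [degIn_eq_zero]
  intro u hu hvu
  rw [mem_far, degIn_eq_zero] at hu
  exact hu.2.2 v h hvu.symm

/-- The total degree deficiency of `T`. -/
noncomputable def deficit (G : SimpleGraph V) (W T : Finset V) : ℕ :=
  ∑ v ∈ T, (3 - G.degIn W v)

/-- The contribution of a boundary vertex of `T` with more neighbours in `T` than necessary. -/
noncomputable def slackAt (G : SimpleGraph V) (W T : Finset V) (b : V) : ℕ :=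
  G.degIn T b - 1 - G.degIn (G.far W T) b

/-- The total contribution of the boundary vertices of `T`. -/
noncomputable def slack (G : SimpleGraph V) (W T : Finset V) : ℕ :=
  ∑ b ∈ G.boundary W T, G.slackAt W T b

/-- The number of edges between the boundary of `T` and the vertices far from `T`. -/
noncomputable def crossing (G : SimpleGraph V) (W T : Finset V) : ℕ :=
  ∑ x ∈ G.far W T, G.degIn (G.boundary W T) x

/-- A matched tree to which no pendant path of length two can be attached. -/
structure IsStuck (G : SimpleGraph V) (W T : Finset V) : Prop extends G.IsMatchedTree T where
  subset : T ⊆ W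
  nonempty : T.Nonempty
  degIn_far : ∀ b ∈ G.boundary W T, G.degIn T b = 1 → G.degIn (G.far W T) b = 0

/-- With one neighbour in the tree there is no far neighbour, by stuckness; with two or three, the
degree bound 3 leaves room for at most one or none. -/
lemma IsStuck.one_add_le {W T : Finset V} (hW : G.IsUnexceptional W) (h : G.IsStuck W T) {b : V}
    (hb : b ∈ G.boundary W T) : 1 + G.degIn (G.far W T) b ≤ G.degIn T b := by
  have h1 := h.degIn_far b hb
  have h2 := degIn_eq_sum_parts (G := G) h.subset b
  have h3 := hW.degIn_le b
  rw [mem_boundary] at hb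
  omega

/-- A tree has degree sum `2|T| - 2`, and a vertex of `T` has no far neighbours, so all that is
missing from `3|T|` is deficit or goes to the boundary. -/
lemma IsStuck.deficit_add_sum_degIn {W T : Finset V} (hW : G.IsUnexceptional W)
    (h : G.IsStuck W T) :
    G.deficit W T + ∑ v ∈ T, G.degIn (G.boundary W T) v = T.card + 2 := by
  have h1 : G.deficit W T + ∑ v ∈ T, G.degIn W v = 3 * T.card := by
    unfold deficit
    rw [← Finset.sum_add_distrib, mul_comm, ← smul_eq_mul, ← Finset.sum_const]
    refine Finset.sum_congr rfl fun v _ => ?_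
    have := hW.degIn_le v
    omega
  have h2 : ∑ v ∈ T, G.degIn W v =
      ∑ v ∈ T, G.degIn T v + ∑ v ∈ T, G.degIn (G.boundary W T) v := by
    rw [← Finset.sum_add_distrib]
    refine Finset.sum_congr rfl fun v hv => ?_
    rw [degIn_eq_sum_parts h.subset v, degIn_far_eq_zero_of_mem hv]
    ring
  have h7 := h.sum_degIn
  omega

/-- Double counting of the edges between the tree and its boundary. This identity converts deficit,
slack and crossing edges into the gain needed for a reduction. -/
lemma IsStuck.sum_eq {W T : Finset V} (hW : G.IsUnexceptional W) (h : G.IsStuck W T) :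
    G.deficit W T + G.slack W T + G.crossing W T + W.card
      = 2 * T.card + 2 + (G.far W T).card := by
  have h1 := h.deficit_add_sum_degIn hW
  have h3 : G.slack W T + ((G.boundary W T).card + ∑ b ∈ G.boundary W T, G.degIn (G.far W T) b)
      = ∑ b ∈ G.boundary W T, G.degIn T b := by
    unfold slack slackAt
    rw [Finset.card_eq_sum_ones, ← Finset.sum_add_distrib, ← Finset.sum_add_distrib]
    -- By `one_add_le` the truncated subtractions in `slackAt` are exact.
    refine Finset.sum_congr rfl fun b hb => ?_
    have := h.one_add_le hW hb
    omega
  have h4 : W.card = T.card + ((G.boundary W T).card + (G.far W T).card) := by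
    conv_lhs => rw [← union_boundary_far (G := G) h.subset]
    rw [Finset.card_union_of_disjoint (disjoint_boundary_union_far W T),
      Finset.card_union_of_disjoint (disjoint_boundary_far W T)]
  have h5 := sum_degIn_comm (G := G) T (G.boundary W T)
  have h6 := sum_degIn_comm (G := G) (G.boundary W T) (G.far W T)
  unfold crossing
  omega

lemma IsStuck.isReducible {W T : Finset V} (hW : G.IsUnexceptional W) (h : G.IsStuck W T)
    (hsum : ∀ 𝒳, G.IsExceptionalFamily (G.far W T) 𝒳 →
      ∑ X ∈ 𝒳, G.loss X + 2 ≤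
        G.deficit W T + G.slack W T + G.crossing W T + (1 - W.card % 2)) :
    G.IsReducible W := by
  refine ⟨T, h.subset, h.nonempty, h.forest, h.mating, G.far W T,
    fun v hv => (mem_far.1 hv).1, disjoint_far W T, fun t ht c hc htc => ?_, fun 𝒳 h𝒳 => ?_⟩
  · exact degIn_eq_zero.1 (mem_far.1 hc).2.2 t ht htc.symm
  · have h1 := hsum 𝒳 h𝒳
    have h2 := h.sum_eq hW
    omega

lemma IsExceptional.nonempty {X : Finset V} (h : G.IsExceptional X) : X.Nonempty := by
  rcases h with ⟨v, rfl⟩ | ⟨x, y, p, q, r, -, rfl, -⟩ | ⟨x, y, p, q, r, -, rfl, -⟩ |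
    ⟨x, y, z, p, q, r, -, rfl, -⟩ <;> simp

lemma InducesK33.three_le_degIn {X : Finset V} (h : G.InducesK33 X) {v : V} (hv : v ∈ X) :
    3 ≤ G.degIn X v := by
  obtain ⟨x, y, z, p, q, r, h, rfl, -⟩ := h
  simp only [Finset.mem_insert, Finset.mem_singleton] at hv
  rcases hv with rfl | rfl | rfl | rfl | rfl | rfl
  · exact SimpleGraph.three_le_degIn (a := p) (b := q) (c := r) (by simp) (by simp) (by simp)
      h.ne_pq h.ne_pr h.ne_qr h.xp h.xq h.xr
  · exact SimpleGraph.three_le_degIn (a := p) (b := q) (c := r) (by simp) (by simp) (by simp)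
      h.ne_pq h.ne_pr h.ne_qr h.yp h.yq h.yr
  · exact SimpleGraph.three_le_degIn (a := p) (b := q) (c := r) (by simp) (by simp) (by simp)
      h.ne_pq h.ne_pr h.ne_qr h.zp h.zq h.zr
  · exact SimpleGraph.three_le_degIn (a := x) (b := y) (c := z) (by simp) (by simp) (by simp)
      h.ne_xy h.ne_xz h.ne_yz h.xp.symm h.yp.symm h.zp.symm
  · exact SimpleGraph.three_le_degIn (a := x) (b := y) (c := z) (by simp) (by simp) (by simp)
      h.ne_xy h.ne_xz h.ne_yz h.xq.symm h.yq.symm h.zq.symm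
  · exact SimpleGraph.three_le_degIn (a := x) (b := y) (c := z) (by simp) (by simp) (by simp)
      h.ne_xy h.ne_xz h.ne_yz h.xr.symm h.yr.symm h.zr.symm

lemma IsExceptional.eq_singleton_or {X : Finset V} (h : G.IsExceptional X) {v : V} (hv : v ∈ X) :
    X = {v} ∨ 2 ≤ G.degIn X v := by
  rcases h with ⟨v, rfl⟩ | ⟨x, y, p, q, r, h, rfl, -⟩ | ⟨a, b, c, d, s, h, rfl, -⟩ | h
  · exact Or.inl (by rw [Finset.mem_singleton.1 hv])
  · right
    rw [two_le_degIn]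
    simp only [Finset.mem_insert, Finset.mem_singleton] at hv
    rcases hv with rfl | rfl | rfl | rfl | rfl
    · exact ⟨p, by simp, q, by simp, h.ne_pq, h.xp, h.xq⟩
    · exact ⟨p, by simp, q, by simp, h.ne_pq, h.yp, h.yq⟩
    · exact ⟨x, by simp, y, by simp, h.ne_xy, h.xp.symm, h.yp.symm⟩
    · exact ⟨x, by simp, y, by simp, h.ne_xy, h.xq.symm, h.yq.symm⟩
    · exact ⟨x, by simp, y, by simp, h.ne_xy, h.xr.symm, h.yr.symm⟩
  · right
    rw [two_le_degIn]
    simp only [Finset.mem_insert, Finset.mem_singleton] at hv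
    rcases hv with rfl | rfl | rfl | rfl | rfl
    · exact ⟨c, by simp, d, by simp, h.cd.ne, h.ac, h.ad⟩
    · exact ⟨c, by simp, d, by simp, h.cd.ne, h.bc, h.bd⟩
    · exact ⟨a, by simp, b, by simp, h.ne_ab, h.ac.symm, h.bc.symm⟩
    · exact ⟨a, by simp, b, by simp, h.ne_ab, h.ad.symm, h.bd.symm⟩
    · exact ⟨a, by simp, b, by simp, h.ne_ab, h.sa, h.sb⟩
  · exact Or.inr (le_trans (by norm_num) (h.three_le_degIn hv))

/-! ### Edges leaving the exceptional components of the far set -/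

section Family
variable {W T : Finset V} {𝒳 : Finset (Finset V)}

/-- Otherwise the component would be closed under adjacency, hence equal to `W` by connectedness,
and `W` is not exceptional. -/
lemma IsExceptionalFamily.exists_adj_boundary (hW : G.IsUnexceptional W)
    (h : G.IsExceptionalFamily (G.far W T) 𝒳) {X : Finset V} (hX : X ∈ 𝒳) :
    ∃ x ∈ X, ∃ b ∈ G.boundary W T, G.Adj x b := by
  by_contra! hno
  have hXW : X ⊆ W := fun v hv => (mem_far.1 (h.subset X hX hv)).1
  refine hW.not_exceptional (hW.conn X hXW (h.exceptional X hX).nonempty (fun x hx y hxy => ?_) ▸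
    h.exceptional X hX)
  have hyW := hW.mem hxy
  have hx' := mem_far.1 (h.subset X hX hx)
  have hyT : y ∉ T := fun hy => degIn_eq_zero.1 hx'.2.2 y hy hxy
  by_cases hy0 : G.degIn T y = 0
  · exact h.closed X hX x hx y (mem_far.2 ⟨hyW, hyT, hy0⟩) hxy
  · exact absurd hxy (hno x hx y (mem_boundary.2 ⟨hyW, hyT, Nat.pos_of_ne_zero hy0⟩))

lemma IsExceptionalFamily.degIn_eq (hT : T ⊆ W)
    (h : G.IsExceptionalFamily (G.far W T) 𝒳) {X : Finset V} (hX : X ∈ 𝒳) {x : V} (hx : x ∈ X) :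
    G.degIn W x = G.degIn X x + G.degIn (G.boundary W T) x := by
  rw [degIn_eq_sum_parts hT x, (mem_far.1 (h.subset X hX hx)).2.2]
  have : G.degIn (G.far W T) x = G.degIn X x :=
    le_antisymm (degIn_le_of_forall (h.closed X hX x hx)) (degIn_mono (h.subset X hX) x)
  omega

/-- Every vertex of `K₃,₃` already has degree three inside it, leaving no room for the edge to the
boundary. -/
lemma IsExceptionalFamily.loss_eq_one (hW : G.IsUnexceptional W) (hT : T ⊆ W)
    (h : G.IsExceptionalFamily (G.far W T) 𝒳) {X : Finset V} (hX : X ∈ 𝒳) : G.loss X = 1 := by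
  unfold loss
  rw [if_neg]
  intro h33
  obtain ⟨x, hx, b, hb, hxb⟩ := h.exists_adj_boundary hW hX
  have h1 := h33.three_le_degIn hx
  have h2 := h.degIn_eq hT hX hx
  have h3 := hW.degIn_le x
  have h4 : 0 < G.degIn (G.boundary W T) x := degIn_pos.2 ⟨b, hb, hxb⟩
  omega

lemma IsExceptionalFamily.loss_le (hW : G.IsUnexceptional W) (hT : T ⊆ W)
    (h : G.IsExceptionalFamily (G.far W T) 𝒳) {X : Finset V} (hX : X ∈ 𝒳) :
    G.loss X ≤ ∑ x ∈ X, G.degIn (G.boundary W T) x := by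
  rw [h.loss_eq_one hW hT hX]
  obtain ⟨x, hx, b, hb, hxb⟩ := h.exists_adj_boundary hW hX
  have h4 : 0 < G.degIn (G.boundary W T) x := degIn_pos.2 ⟨b, hb, hxb⟩
  have := Finset.single_le_sum (f := fun x => G.degIn (G.boundary W T) x)
    (fun i _ => Nat.zero_le _) hx
  exact le_trans h4 this

lemma IsExceptionalFamily.sum_sum_le
    (h : G.IsExceptionalFamily (G.far W T) 𝒳) :
    ∑ X ∈ 𝒳, ∑ x ∈ X, G.degIn (G.boundary W T) x ≤ G.crossing W T := by
  rw [← Finset.sum_biUnion (t := fun X => X) (s := 𝒳)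
    (fun X hX Y hY hne => h.disjoint X hX Y hY hne)]
  exact Finset.sum_le_sum_of_subset (Finset.biUnion_subset.2 h.subset)

lemma IsExceptionalFamily.sum_loss_le (hW : G.IsUnexceptional W) (hT : T ⊆ W)
    (h : G.IsExceptionalFamily (G.far W T) 𝒳) :
    ∑ X ∈ 𝒳, G.loss X ≤ G.crossing W T :=
  (Finset.sum_le_sum fun _ hX => h.loss_le hW hT hX).trans h.sum_sum_le

end Family

/-- The crossing edges pay for all losses, so only the constant 2 of `sum_eq` remains to be covered.
-/
lemma IsStuck.isReducible_of_two_le {W T : Finset V} (hW : G.IsUnexceptional W)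
    (h : G.IsStuck W T) (h2 : 2 ≤ G.deficit W T + G.slack W T + (1 - W.card % 2)) :
    G.IsReducible W :=
  h.isReducible hW fun 𝒳 h𝒳 => by
    have := h𝒳.sum_loss_le hW h.subset
    omega

/-- An inclusion-maximal matched tree. -/
structure IsMaxMatchedTree (G : SimpleGraph V) (W T : Finset V) : Prop extends
    G.IsStuck W T where
  eq_of_subset : ∀ T', G.IsMatchedTree T' → T' ⊆ W → T ⊆ T' → T' = T

omit [DecidableEq V] in
lemma IsMatchedTree.nonempty {T : Finset V} (h : G.IsMatchedTree T) : T.Nonempty := by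
  rw [Finset.nonempty_iff_ne_empty]
  rintro rfl
  have := h.sum_degIn
  simp at this

/-- A boundary vertex with one neighbour in the tree and a far neighbour would give a larger matched
tree, so inclusion-maximality implies stuckness. -/
lemma IsMatchedTree.exists_isMaxMatchedTree {W T₀ : Finset V} (h : G.IsMatchedTree T₀)
    (hT : T₀ ⊆ W) : ∃ T, T₀ ⊆ T ∧ G.IsMaxMatchedTree W T := by
  classical
  obtain ⟨T, hT', hmax⟩ := (W.powerset.filter fun T => G.IsMatchedTree T).exists_le_maximal
    (a := T₀) (by simp [h, hT])
  have hmem := hmax.prop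
  rw [Finset.mem_filter, Finset.mem_powerset] at hmem
  have heq : ∀ T', G.IsMatchedTree T' → T' ⊆ W → T ⊆ T' → T' = T := fun T' h1 h2 h3 =>
    (hmax.eq_of_le (by simp [h1, h2]) h3).symm
  refine ⟨T, hT', ⟨⟨hmem.2, hmem.1, hmem.2.nonempty, fun b hb hb1 => ?_⟩, heq⟩⟩
  rw [degIn_eq_zero]
  intro x hx hbx
  rw [mem_boundary] at hb
  rw [mem_far] at hx
  have h1 := heq _ (hmem.2.insert_insert hb.2.1 hb1 hx.2.1 hx.2.2 hbx.symm)
    (Finset.insert_subset hx.1 (Finset.insert_subset hb.1 hmem.1))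
    ((Finset.subset_insert _ _).trans (Finset.subset_insert _ _))
  exact hx.2.1 (h1 ▸ Finset.mem_insert_self _ _)

omit [DecidableEq V] in
lemma le_deficit {W T : Finset V} {v : V} (hv : v ∈ T) :
    3 - G.degIn W v ≤ G.deficit W T :=
  Finset.single_le_sum (f := fun v => 3 - G.degIn W v) (fun _ _ => Nat.zero_le _) hv

end
-- Reducible configurations: `K₄⁺`, `K₂,₃` and vertices of low degree
section
variable {V : Type*} {G : SimpleGraph V} [DecidableEq V] {W : Finset V}

lemma IsUnexceptional.eq_of_adj (hW : G.IsUnexceptional W) {v a b c u : V}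
    (hab : a ≠ b) (hac : a ≠ c) (hbc : b ≠ c)
    (hva : G.Adj v a) (hvb : G.Adj v b) (hvc : G.Adj v c) (hvu : G.Adj v u) :
    u = a ∨ u = b ∨ u = c :=
  eq_of_adj_of_degIn_le_three (hW.degIn_le v) (hW.mem hva) (hW.mem hvb) (hW.mem hvc) hab hac hbc
    hva hvb hvc (hW.mem hvu) hvu

/-- The source of slack used throughout: a vertex left out of the tree with two neighbours in it and
no far neighbour. -/
lemma IsUnexceptional.one_le_slackAt (hW : G.IsUnexceptional W) {T : Finset V}
    {y : V} (hy : y ∉ T) (h2 : 2 ≤ G.degIn T y)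
    (hn : ∀ u, G.Adj y u → u ∈ T ∨ 0 < G.degIn T u) :
    y ∈ G.boundary W T ∧ 1 ≤ G.slackAt W T y := by
  obtain ⟨a, -, -, -, -, hya, -⟩ := two_le_degIn.1 h2
  refine ⟨mem_boundary.2 ⟨hW.mem hya.symm, hy, by omega⟩, ?_⟩
  have : G.degIn (G.far W T) y = 0 := by
    rw [degIn_eq_zero]
    intro u hu hyu
    rw [mem_far] at hu
    rcases hn u hyu with h1 | h1
    · exact hu.2.1 h1
    · omega
  unfold slackAt
  omega

lemma one_le_slack {T : Finset V} {y : V} (hy : y ∈ G.boundary W T ∧ 1 ≤ G.slackAt W T y) :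
    1 ≤ G.slack W T :=
  hy.2.trans (Finset.single_le_sum (f := fun v => G.slackAt W T v) (fun _ _ => Nat.zero_le _) hy.1)

lemma two_le_slack {T : Finset V} {y z : V} (hy : y ∈ G.boundary W T ∧ 1 ≤ G.slackAt W T y)
    (hz : z ∈ G.boundary W T ∧ 1 ≤ G.slackAt W T z) (hyz : y ≠ z) : 2 ≤ G.slack W T := by
  have h1 : ∑ v ∈ {y, z}, G.slackAt W T v ≤ G.slack W T :=
    Finset.sum_le_sum_of_subset (Finset.insert_subset hy.1 (Finset.singleton_subset_iff.2 hz.1))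
  rw [Finset.sum_pair hyz] at h1
  omega

/-- The single edge `c d` is already stuck: its boundary is `a`, `b`, both seeing `c` and `d`. The
edges `s a` and `s b` cross, which pays the constant 2 provided there is no loss. -/
theorem isReducible_of_isK4PlusPattern (hW : G.IsUnexceptional W) {a b c d s : V}
    (P : G.IsK4PlusPattern a b c d s) : G.IsReducible W := by
  obtain ⟨hab, hsc, hsd, hcd, hac, had, hbc, hbd, hsa, hsb⟩ := P
  have hNa : ∀ u, G.Adj a u → u = c ∨ u = d ∨ u = s := fun u hu =>
    hW.eq_of_adj hcd.ne hsc.symm hsd.symm hac had hsa.symm hu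
  have hNb : ∀ u, G.Adj b u → u = c ∨ u = d ∨ u = s := fun u hu =>
    hW.eq_of_adj hcd.ne hsc.symm hsd.symm hbc hbd hsb.symm hu
  have hNc : ∀ u, G.Adj c u → u = a ∨ u = b ∨ u = d := fun u hu =>
    hW.eq_of_adj hab had.ne hbd.ne hac.symm hbc.symm hcd hu
  have hNd : ∀ u, G.Adj d u → u = a ∨ u = b ∨ u = c := fun u hu =>
    hW.eq_of_adj hab hac.ne hbc.ne had.symm hbd.symm hcd.symm hu
  have hmT : ∀ u, u ∈ ({c, d} : Finset V) ↔ u = c ∨ u = d := by simp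
  have haT : a ∉ ({c, d} : Finset V) := by simp [hac.ne, had.ne]
  have hbT : b ∉ ({c, d} : Finset V) := by simp [hbc.ne, hbd.ne]
  have ha2 : 2 ≤ G.degIn {c, d} a :=
    two_le_degIn.2 ⟨c, by simp, d, by simp, hcd.ne, hac, had⟩
  have hb2 : 2 ≤ G.degIn {c, d} b :=
    two_le_degIn.2 ⟨c, by simp, d, by simp, hcd.ne, hbc, hbd⟩
  have hB : ∀ v ∈ G.boundary W {c, d}, v = a ∨ v = b := by
    intro v hv
    rw [mem_boundary, degIn_pos, hmT, not_or] at hv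
    obtain ⟨-, ⟨hvc, hvd⟩, u, hu, hvu⟩ := hv
    rcases (hmT u).1 hu with rfl | rfl
    · have := hNc v hvu.symm
      tauto
    · have := hNd v hvu.symm
      tauto
  have haB : a ∈ G.boundary W {c, d} := mem_boundary.2 ⟨hW.mem hsa, haT, by omega⟩
  have hbB : b ∈ G.boundary W {c, d} := mem_boundary.2 ⟨hW.mem hsb, hbT, by omega⟩
  have hTW : ({c, d} : Finset V) ⊆ W :=
    Finset.insert_subset (hW.mem hac) (Finset.singleton_subset_iff.2 (hW.mem had))
  have hs0 : G.degIn {c, d} s = 0 := by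
    rw [degIn_eq_zero]
    intro u hu hsu
    rcases (hmT u).1 hu with rfl | rfl
    · rcases hNc s hsu.symm with h | h | h
      · exact hsa.ne h
      · exact hsb.ne h
      · exact hsd h
    · rcases hNd s hsu.symm with h | h | h
      · exact hsa.ne h
      · exact hsb.ne h
      · exact hsc h
  have hsC : s ∈ G.far W {c, d} := mem_far.2 ⟨hW.mem hsa.symm, by simp [hsc, hsd], hs0⟩
  have hs2 : 2 ≤ G.degIn (G.boundary W {c, d}) s :=
    two_le_degIn.2 ⟨a, haB, b, hbB, hab, hsa, hsb⟩
  have hstuck : G.IsStuck W {c, d} := by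
    refine ⟨isMatchedTree_pair hcd, hTW, by simp, fun v hv hv1 => ?_⟩
    rcases hB v hv with rfl | rfl <;> omega
  refine hstuck.isReducible hW fun 𝒳 h𝒳 => ?_
  have hcross : 2 ≤ G.crossing W {c, d} :=
    hs2.trans (Finset.single_le_sum (f := fun v => G.degIn (G.boundary W {c, d}) v)
      (fun _ _ => Nat.zero_le _) hsC)
  -- Only `s` joins the far set to the boundary, so an exceptional component contains `s`. There `s`
  -- has degree at most one, so the component is `{s}` and `W` is a `K₄⁺`.
  have hempty : 𝒳 = ∅ := by
    rw [Finset.eq_empty_iff_forall_notMem]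
    intro X hX
    obtain ⟨x, hx, v, hv, hxv⟩ := h𝒳.exists_adj_boundary hW hX
    have hxs : x = s := by
      have h1 : x = c ∨ x = d ∨ x = s := by
        rcases hB v hv with rfl | rfl
        · exact hNa x hxv.symm
        · exact hNb x hxv.symm
      have h2 := (mem_far.1 (h𝒳.subset X hX hx)).2.1
      rw [hmT] at h2
      tauto
    subst hxs
    have h3 := h𝒳.degIn_eq hTW hX hx
    have h4 := hW.degIn_le x
    rcases (h𝒳.exceptional X hX).eq_singleton_or hx with rfl | h5
    · have hNs : ∀ u, G.Adj x u → u = a ∨ u = b := by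
        intro u hxu
        have huW := hW.mem hxu
        rw [← union_boundary_far (G := G) hTW, Finset.mem_union, Finset.mem_union] at huW
        rcases huW with h6 | h6 | h6
        · exact absurd hxu (degIn_eq_zero.1 hs0 u h6)
        · exact hB u h6
        · have := h𝒳.closed _ hX x hx u h6 hxu
          rw [Finset.mem_singleton] at this
          exact absurd this hxu.ne'
      have hWeq : ({a, b, c, d, x} : Finset V) = W := by
        refine hW.conn _ ?_ ⟨a, by simp⟩ ?_
        · intro u hu
          simp only [Finset.mem_insert, Finset.mem_singleton] at hu
          rcases hu with rfl | rfl | rfl | rfl | rfl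
          · exact hW.mem hsa
          · exact hW.mem hsb
          · exact hW.mem hac
          · exact hW.mem had
          · exact hW.mem hsa.symm
        · intro u hu w huw
          simp only [Finset.mem_insert, Finset.mem_singleton] at hu ⊢
          rcases hu with rfl | rfl | rfl | rfl | rfl
          · have := hNa w huw
            tauto
          · have := hNb w huw
            tauto
          · have := hNc w huw
            tauto
          · have := hNd w huw
            tauto
          · have := hNs w huw
            tauto
      refine hW.not_exceptional (Or.inr (Or.inr (Or.inl ⟨a, b, c, d, x,
        ⟨hab, hsc, hsd, hcd, hac, had, hbc, hbd, hsa, hsb⟩, hWeq.symm, fun h => ?_, fun h => ?_,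
        fun h => ?_⟩)))
      · rcases hNa b h with h6 | h6 | h6
        · exact hbc.ne h6
        · exact hbd.ne h6
        · exact hsb.ne' h6
      · rcases hNs c h with h6 | h6
        · exact hac.ne' h6
        · exact hbc.ne' h6
      · rcases hNs d h with h6 | h6
        · exact had.ne' h6
        · exact hbd.ne' h6
    · omega
  subst hempty
  simp only [Finset.sum_empty]
  omega

/-- An induced path on four vertices is a matched tree. -/
lemma isMatchedTree_path {a b c d : V} (hab : G.Adj a b) (hbc : G.Adj b c) (hcd : G.Adj c d)
    (hac : ¬ G.Adj a c) (had : ¬ G.Adj a d) (hbd : ¬ G.Adj b d) (hne : a ≠ c) (hne' : a ≠ d)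
    (hne'' : b ≠ d) : G.IsMatchedTree {a, b, c, d} := by
  refine (isMatchedTree_pair hcd).insert_insert (b := b) (x := a) ?_ ?_ ?_ ?_ hab
  · simp [hbc.ne, hne'']
  · exact degIn_eq_one.2 ⟨c, by simp, hbc, by simp [hbd]⟩
  · simp [hne, hne']
  · simp [degIn_eq_zero, hac, had]

lemma IsUnexceptional.subset_of_forall_adj (hW : G.IsUnexceptional W) {A : Finset V}
    (h : ∀ a ∈ A, ∃ b, G.Adj a b) : A ⊆ W := fun a ha => by
  obtain ⟨b, hb⟩ := h a ha
  exact hW.mem hb.symm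

omit [DecidableEq V] in
lemma IsK23Pattern.perm {x y p q r : V} (h : G.IsK23Pattern x y p q r) :
    G.IsK23Pattern x y q p r :=
  ⟨h.ne_xy, h.ne_pq.symm, h.ne_qr, h.ne_pr, h.xq, h.xp, h.xr, h.yq, h.yp, h.yr⟩

omit [DecidableEq V] in
lemma IsK23Pattern.rotate {x y p q r : V} (h : G.IsK23Pattern x y p q r) :
    G.IsK23Pattern x y q r p :=
  ⟨h.ne_xy, h.ne_qr, h.ne_pq.symm, h.ne_pr.symm, h.xq, h.xr, h.xp, h.yq, h.yr, h.yp⟩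

omit [DecidableEq V] in
/-- Three common neighbours of two vertices are independent, or there is a `K₄⁺`. -/
lemma IsK23Pattern.isK4PlusPattern {x y p q r : V} (h : G.IsK23Pattern x y p q r)
    (hpq : G.Adj p q) : G.IsK4PlusPattern x y p q r :=
  ⟨h.ne_xy, h.ne_pr.symm, h.ne_qr.symm, hpq, h.xp, h.xq, h.yp, h.yq, h.xr.symm, h.yr.symm⟩

lemma IsK23Pattern.adj_x {x y p q r : V} (h : G.IsK23Pattern x y p q r)
    (hW : G.IsUnexceptional W) {u : V} (hu : G.Adj x u) : u = p ∨ u = q ∨ u = r :=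
  hW.eq_of_adj h.ne_pq h.ne_pr h.ne_qr h.xp h.xq h.xr hu

lemma IsK23Pattern.adj_y {x y p q r : V} (h : G.IsK23Pattern x y p q r)
    (hW : G.IsUnexceptional W) {u : V} (hu : G.Adj y u) : u = p ∨ u = q ∨ u = r :=
  hW.eq_of_adj h.ne_pq h.ne_pr h.ne_qr h.yp h.yq h.yr hu

/-- Grow a tree from the induced path `r x p p'`, where `p'` is the third neighbour of `p`. It omits
`y`, which would close a four-cycle; `y` yields slack one and `r` deficit one. -/
lemma isReducible_of_isK23Pattern_of_lt {x y p q r : V} (hW : G.IsUnexceptional W)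
    (h : G.IsK23Pattern x y p q r) (hr : G.degIn W r ≤ 2) (hp : 2 < G.degIn W p) :
    G.IsReducible W := by
  by_cases hpq : G.Adj p q
  · exact isReducible_of_isK4PlusPattern hW (h.isK4PlusPattern hpq)
  obtain ⟨p', -, hpp', hp'x, hp'y⟩ := exists_of_two_lt_degIn hp x y
  have hNr : ∀ u, G.Adj r u → u = x ∨ u = y := fun u hu =>
    eq_of_adj_of_degIn_le_two hr (hW.mem h.xr.symm) (hW.mem h.yr.symm) h.ne_xy h.xr.symm h.yr.symm
      (hW.mem hu) hu
  have hrp' : ¬ G.Adj r p' := fun h1 => (hNr _ h1).elim hp'x hp'y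
  have hrp : ¬ G.Adj r p := fun h1 => (hNr _ h1).elim h.xp.ne' h.yp.ne'
  have hp'r : p' ≠ r := fun h1 => hrp (h1 ▸ hpp').symm
  have hp'q : p' ≠ q := fun h1 => hpq (h1 ▸ hpp')
  have hxp' : ¬ G.Adj x p' := fun h1 => by
    rcases h.adj_x hW h1 with h2 | h2 | h2
    · exact hpp'.ne' h2
    · exact hp'q h2
    · exact hp'r h2
  obtain ⟨T, hT, hmax⟩ := (isMatchedTree_path h.xr.symm h.xp hpp' hrp hrp' hxp' h.ne_pr.symm
    hp'r.symm hp'x.symm).exists_isMaxMatchedTree (W := W) (by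
      refine hW.subset_of_forall_adj fun u hu => ?_
      simp only [Finset.mem_insert, Finset.mem_singleton] at hu
      rcases hu with rfl | rfl | rfl | rfl
      · exact ⟨_, h.xr.symm⟩
      · exact ⟨_, h.xr⟩
      · exact ⟨_, hpp'⟩
      · exact ⟨_, hpp'.symm⟩)
  have hrT : r ∈ T := hT (by simp)
  have hxT : x ∈ T := hT (by simp)
  have hpT : p ∈ T := hT (by simp)
  have hyT : y ∉ T := hmax.forest.not_four_cycle hrT hxT hpT h.ne_pr.symm h.ne_xy h.xr.symm h.xp
    h.yp.symm h.yr
  have h1 := one_le_slack (hW.one_le_slackAt hyT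
    (two_le_degIn.2 ⟨r, hrT, p, hpT, h.ne_pr.symm, h.yr, h.yp⟩) (fun u hu => by
      rcases h.adj_y hW hu with rfl | rfl | rfl
      · exact Or.inl hpT
      · exact Or.inr (degIn_pos.2 ⟨x, hxT, h.xq.symm⟩)
      · exact Or.inl hrT))
  have h2 := le_deficit (G := G) (W := W) hrT
  exact hmax.toIsStuck.isReducible_of_two_le hW (by omega)

/-- A `K₂,₃` with a vertex of degree two is reducible. -/
theorem isReducible_of_isK23Pattern {x y p q r : V} (hW : G.IsUnexceptional W)
    (h : G.IsK23Pattern x y p q r) (hr : G.degIn W r ≤ 2) : G.IsReducible W := by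
  by_cases hp : 2 < G.degIn W p
  · exact isReducible_of_isK23Pattern_of_lt hW h hr hp
  by_cases hq : 2 < G.degIn W q
  · exact isReducible_of_isK23Pattern_of_lt hW h.perm hr hq
  -- If `p`, `q`, `r` all have degree two, then `W` is itself a `K₂,₃`.
  exfalso
  have hN : ∀ v, G.Adj x v → G.Adj y v → G.degIn W v ≤ 2 → ∀ u, G.Adj v u → u = x ∨ u = y :=
    fun v hxv hyv hv u hu =>
      eq_of_adj_of_degIn_le_two hv (hW.mem hxv.symm) (hW.mem hyv.symm) h.ne_xy hxv.symm hyv.symm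
        (hW.mem hu) hu
  have hNp := hN p h.xp h.yp (by omega)
  have hNq := hN q h.xq h.yq (by omega)
  have hNr := hN r h.xr h.yr hr
  have hWeq : ({x, y, p, q, r} : Finset V) = W := by
    refine hW.conn _ (hW.subset_of_forall_adj fun u hu => ?_) ⟨x, by simp⟩ fun u hu w huw => ?_
    · simp only [Finset.mem_insert, Finset.mem_singleton] at hu
      rcases hu with rfl | rfl | rfl | rfl | rfl
      · exact ⟨_, h.xp⟩
      · exact ⟨_, h.yp⟩
      · exact ⟨_, h.xp.symm⟩
      · exact ⟨_, h.xq.symm⟩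
      · exact ⟨_, h.xr.symm⟩
    · simp only [Finset.mem_insert, Finset.mem_singleton] at hu ⊢
      rcases hu with rfl | rfl | rfl | rfl | rfl
      · have := h.adj_x hW huw
        tauto
      · have := h.adj_y hW huw
        tauto
      · have := hNp w huw
        tauto
      · have := hNq w huw
        tauto
      · have := hNr w huw
        tauto
  refine hW.not_exceptional (Or.inr (Or.inl ⟨x, y, p, q, r, h, hWeq.symm, fun h1 => ?_,
    fun h1 => ?_, fun h1 => ?_, fun h1 => ?_⟩))
  · rcases h.adj_x hW h1 with rfl | rfl | rfl
    · exact G.irrefl h.yp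
    · exact G.irrefl h.yq
    · exact G.irrefl h.yr
  · exact (hNp _ h1).elim h.xq.ne' h.yq.ne'
  · exact (hNp _ h1).elim h.xr.ne' h.yr.ne'
  · exact (hNq _ h1).elim h.xr.ne' h.yr.ne'

/-- A vertex of degree at most one is reducible. -/
theorem isReducible_of_degIn_le_one (hW : G.IsUnexceptional W) {v : V} (hvW : v ∈ W)
    (hv : G.degIn W v ≤ 1) : G.IsReducible W := by
  obtain ⟨u, hvu⟩ : ∃ u, G.Adj v u := by
    by_contra! hno
    refine hW.not_exceptional (Or.inl ⟨v, (hW.conn {v} (by simpa) (by simp) ?_).symm⟩)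
    intro x hx y hxy
    rw [Finset.mem_singleton.1 hx] at hxy
    exact absurd hxy (hno y)
  obtain ⟨T, hT, hmax⟩ := (isMatchedTree_pair hvu).exists_isMaxMatchedTree (W := W)
    (Finset.insert_subset hvW (Finset.singleton_subset_iff.2 (hW.mem hvu)))
  -- The vertex `v` alone contributes a deficit of at least two.
  have h2 := le_deficit (G := G) (W := W) (hT (Finset.mem_insert_self v {u}))
  exact hmax.toIsStuck.isReducible_of_two_le hW (by omega)

/-- If there is no reducible `K₂,₃`, `K₄⁺` or vertex of degree one, a nonempty set of far vertices
yields a gain of one. -/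
lemma IsExceptionalFamily.sum_loss_lt (hW : G.IsUnexceptional W) {T : Finset V} (hT : T ⊆ W)
    (hne : T.Nonempty) {𝒳 : Finset (Finset V)}
    (h : G.IsExceptionalFamily (G.far W T) 𝒳) (hC : (G.far W T).Nonempty)
    (hdeg : ∀ v ∈ W, 2 ≤ G.degIn W v)
    (hK23 : ∀ x y p q r, G.IsK23Pattern x y p q r → 2 < G.degIn W r)
    (hK4 : ∀ a b c d s, ¬ G.IsK4PlusPattern a b c d s) :
    ∑ X ∈ 𝒳, G.loss X < G.crossing W T := by
  by_cases hemp : 𝒳 = ∅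
  · subst hemp
    -- Without losses one crossing edge is enough; if there were none, the far set would be closed
    -- and thus all of `W`.
    rw [Finset.sum_empty, Nat.pos_iff_ne_zero]
    intro h0
    have h1 := Finset.sum_eq_zero_iff.1 h0
    have h2 := hW.conn (G.far W T) (fun v hv => (mem_far.1 hv).1) hC (fun x hx y hxy => by
      have hyW := hW.mem hxy
      rw [← union_boundary_far (G := G) hT, Finset.mem_union, Finset.mem_union] at hyW
      rcases hyW with h3 | h3 | h3
      · exact absurd hxy (degIn_eq_zero.1 (mem_far.1 hx).2.2 y h3)
      · exact absurd hxy (degIn_eq_zero.1 (h1 x hx) y h3)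
      · exact h3)
    obtain ⟨t, ht⟩ := hne
    exact (mem_far.1 (h2 ▸ hT ht)).2.1 ht
  · obtain ⟨X, hX⟩ := Finset.nonempty_iff_ne_empty.2 hemp
    -- One member with two edges to the boundary suffices. A single vertex has them since degrees
    -- are at least two; in a `K₂,₃`, both `p` and `q` have a third neighbour outside.
    refine lt_of_lt_of_le (Finset.sum_lt_sum (fun Y hY => h.loss_le hW hT hY) ⟨X, hX, ?_⟩)
      h.sum_sum_le
    rw [h.loss_eq_one hW hT hX]
    rcases h.exceptional X hX with ⟨v, rfl⟩ | ⟨x, y, p, q, r, P, hXe, -, h1, h2, h3⟩ |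
      ⟨a, b, c, d, s, P, -⟩ | h33
    · rw [Finset.sum_singleton]
      have hv := mem_far.1 (h.subset _ hX (Finset.mem_singleton_self v))
      have h1 := hdeg v hv.1
      rw [h.degIn_eq hT hX (Finset.mem_singleton_self v)] at h1
      have : G.degIn {v} v = 0 := by simp [degIn_eq_zero]
      omega
    · have hpos : ∀ v ∈ X, 2 < G.degIn W v → G.degIn X v ≤ 2 →
          1 ≤ G.degIn (G.boundary W T) v := by
        intro v hv h4 h5
        have := h.degIn_eq hT hX hv
        omega
      have hle : ∀ v, (∀ u ∈ X, G.Adj v u → u = x ∨ u = y) → G.degIn X v ≤ 2 := by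
        intro v hv
        refine le_trans (Finset.card_le_card (t := {x, y}) fun u hu => ?_) Finset.card_le_two
        rw [mem_nbrIn] at hu
        simpa using hv u hu.1 hu.2
      have hmX : ∀ u ∈ X, u = x ∨ u = y ∨ u = p ∨ u = q ∨ u = r := by
        subst hXe
        simp
      have hp := hpos p (by simp [hXe]) (hK23 _ _ _ _ _ P.rotate) (hle p fun u hu hpu => by
        rcases hmX u hu with rfl | rfl | rfl | rfl | rfl <;>
          first | tauto | exact absurd hpu G.irrefl)
      have hq := hpos q (by simp [hXe]) (hK23 _ _ _ _ _ P.rotate.rotate) (hle q fun u hu hpu => by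
        rcases hmX u hu with rfl | rfl | rfl | rfl | rfl <;>
          first | tauto | exact absurd hpu G.irrefl)
      have h4 : ∑ v ∈ {p, q}, G.degIn (G.boundary W T) v ≤
          ∑ v ∈ X, G.degIn (G.boundary W T) v :=
        Finset.sum_le_sum_of_subset (by subst hXe; intro u; simp; tauto)
      rw [Finset.sum_pair P.ne_pq] at h4
      omega
    · exact absurd P (hK4 _ _ _ _ _)
    · have := h.loss_eq_one hW hT hX
      unfold loss at this
      rw [if_pos h33] at this
      omega

end
-- Maximal matched trees and the reduction of all unexceptional graphs
section
variable {V : Type*} {G : SimpleGraph V} [DecidableEq V] {W : Finset V}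

lemma even_sum_degIn (G : SimpleGraph V) (U : Finset V) : Even (∑ u ∈ U, G.degIn U u) := by
  induction U using Finset.induction_on with
  | empty => simp
  | insert v U hv ih =>
    rw [sum_degIn_insert hv]
    exact ih.add (even_two_mul _)

/-- Attaching a leaf at each end of a matching edge. -/
lemma IsMatchedTree.augment {T : Finset V} (h : G.IsMatchedTree T) {v w b b' : V}
    (hv : v ∈ T) (hw : w ∈ T) (hvw : v ≠ w) (hm : G.HasMating (T \ {v, w})) (hb : b ∉ T)
    (hb' : b' ∉ T) (hbT : G.degIn T b = 1) (hbT' : G.degIn T b' = 1) (hne : b ≠ b')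
    (hbv : G.Adj b v) (hbw : G.Adj b' w) (hbb' : ¬ G.Adj b b') :
    G.IsMatchedTree (insert b' (insert b T)) := by
  refine ⟨(h.toIsTreeOn.insert hb hbT).insert (by simp [hb', hne.symm]) ?_, ?_⟩
  · rw [degIn_insert hb, hbT', if_neg fun h1 => hbb' h1.symm]
  · have h1 := (hm.insert_insert (a := b) (b := v) (by simp [hb]) (by simp) hbv).insert_insert
      (a := b') (b := w) (by
        have : b' ≠ v := fun h2 => hb' (h2 ▸ hv)
        simp [hb', hne.symm, this]) (by
        have : w ≠ b := fun h2 => hb (h2 ▸ hw)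
        simp [this, hvw.symm]) hbw
    convert h1 using 1
    ext u
    simp only [Finset.mem_insert, Finset.mem_sdiff, Finset.mem_singleton]
    by_cases h2 : u = v
    · simp [h2, hv]
    · by_cases h3 : u = w
      · simp [h3, hw]
      · simp [h2, h3]

omit [DecidableEq V] in
lemma sum_comp_of_isMating {T : Finset V} {f : V → V} (hf : G.IsMating f T) (g : V → ℕ) :
    ∑ v ∈ T, g (f v) = ∑ v ∈ T, g v :=
  Finset.sum_nbij' f f (fun v hv => (hf v hv).1) (fun v hv => (hf v hv).1)
    (fun v hv => (hf v hv).2.2) (fun v hv => (hf v hv).2.2) (fun _ _ => rfl)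

/-- A maximal matched tree without any gain contains a matching edge lying in a `K₂,₃` whose
other vertices are outside the tree. -/
lemma IsMaxMatchedTree.exists_isK23Pattern (hW : G.IsUnexceptional W) {T : Finset V}
    (h : G.IsMaxMatchedTree W T) (hfar : G.far W T = ∅) (hslack : G.slack W T = 0)
    (hdef : G.deficit W T ≤ 1) :
    (∀ b ∈ W, b ∉ T → G.degIn T b = 1) ∧
    ∃ l ∈ T, ∃ p ∈ T, ∃ b₁ b₂ b₃, b₁ ∉ T ∧ b₂ ∉ T ∧ b₃ ∉ T ∧ G.IsK23Pattern l b₃ b₁ b₂ p ∧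
      G.HasMating (T \ {l, p}) ∧
      ∀ b b', b ∉ T → b' ∉ T → G.Adj b l → G.Adj b' p → b ≠ b' → G.Adj b b' := by
  have hone : ∀ b ∈ W, b ∉ T → G.degIn T b = 1 := by
    intro b hb hbT
    have hb0 : G.degIn T b ≠ 0 := fun h0 => by
      have : b ∈ G.far W T := mem_far.2 ⟨hb, hbT, h0⟩
      rw [hfar] at this
      exact absurd this (Finset.notMem_empty b)
    have h1 := Finset.sum_eq_zero_iff.1 hslack b (mem_boundary.2 ⟨hb, hbT, by omega⟩)
    unfold slackAt at h1
    have h2 : G.degIn (G.far W T) b = 0 := by simp [hfar, degIn_eq_zero]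
    omega
  refine ⟨hone, ?_⟩
  obtain ⟨f, hf⟩ := h.mating
  have hsum := h.deficit_add_sum_degIn hW
  have hle : ∀ v ∈ T, G.degIn (G.boundary W T) v ≤ 2 := by
    intro v hv
    have h1 := degIn_eq_sum_parts (G := G) h.subset v
    have h2 := hW.degIn_le v
    have h3 : 0 < G.degIn T v := degIn_pos.2 ⟨f v, (hf v hv).1, (hf v hv).2.1⟩
    omega
  -- The boundary degrees sum to `|T| + 2 - deficit ≥ |T| + 1`, so their average over a matching
  -- edge exceeds two.
  obtain ⟨v, hv, h3⟩ : ∃ v ∈ T, 3 ≤ G.degIn (G.boundary W T) v +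
      G.degIn (G.boundary W T) (f v) := by
    by_contra! hno
    have h1 : ∑ v ∈ T, (G.degIn (G.boundary W T) v + G.degIn (G.boundary W T) (f v)) ≤
        T.card * 2 := by
      rw [← smul_eq_mul, ← Finset.sum_const]
      exact Finset.sum_le_sum fun v hv => Nat.lt_succ_iff.1 (hno v hv)
    rw [Finset.sum_add_distrib, sum_comp_of_isMating hf] at h1
    omega
  have hexists : ∃ l ∈ T, 2 ≤ G.degIn (G.boundary W T) l ∧
      1 ≤ G.degIn (G.boundary W T) (f l) := by
    obtain ⟨h4, -, h5⟩ := hf v hv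
    have h6 := hle v hv
    have h7 := hle _ h4
    by_cases h8 : 2 ≤ G.degIn (G.boundary W T) v
    · exact ⟨v, hv, h8, by omega⟩
    · exact ⟨f v, h4, by omega, by rw [h5]; omega⟩
  obtain ⟨l, hl, h4, h5⟩ := hexists
  obtain ⟨hp, hlp, -⟩ := hf l hl
  have hm := (⟨f, hf.sdiff_pair hl⟩ : G.HasMating (T \ {l, f l}))
  generalize f l = p at *
  -- Nonadjacent `b`, `b'` would allow `augment`, against maximality.
  have hadj : ∀ b b', b ∉ T → b' ∉ T → G.Adj b l → G.Adj b' p → b ≠ b' → G.Adj b b' := by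
    intro b b' hb hb' hbl hbp hne
    by_contra hbb
    have hbW := hW.mem hbl.symm
    have hbW' := hW.mem hbp.symm
    have h6 := h.eq_of_subset _ (h.augment hl hp hlp.ne hm hb hb' (hone b hbW hb)
      (hone b' hbW' hb') hne hbl hbp hbb)
      (Finset.insert_subset hbW' (Finset.insert_subset hbW h.subset))
      ((Finset.subset_insert _ _).trans (Finset.subset_insert _ _))
    exact hb' (h6 ▸ Finset.mem_insert_self _ _)
  obtain ⟨b₁, hb₁, b₂, hb₂, h12, hlb₁, hlb₂⟩ := two_le_degIn.1 h4
  obtain ⟨b₃, hb₃, hpb₃⟩ := degIn_pos.1 h5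
  rw [mem_boundary] at hb₁ hb₂ hb₃
  have hl3 : ¬ G.Adj b₃ l := by
    intro h6
    have h7 := hone b₃ hb₃.1 hb₃.2.1
    have h8 : 2 ≤ G.degIn T b₃ := two_le_degIn.2 ⟨l, hl, p, hp, hlp.ne, h6, hpb₃.symm⟩
    omega
  have h13 := hadj b₁ b₃ hb₁.2.1 hb₃.2.1 hlb₁.symm hpb₃.symm (fun h => hl3 (h ▸ hlb₁.symm))
  have h23 := hadj b₂ b₃ hb₂.2.1 hb₃.2.1 hlb₂.symm hpb₃.symm (fun h => hl3 (h ▸ hlb₂.symm))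
  refine ⟨l, hl, p, hp, b₁, b₂, b₃, hb₁.2.1, hb₂.2.1, hb₃.2.1, ⟨?_, h12, ?_, ?_, hlb₁, hlb₂, hlp,
    h13.symm, h23.symm, hpb₃.symm⟩, hm, hadj⟩
  · exact fun h => hb₃.2.1 (h ▸ hl)
  · exact fun h => hb₁.2.1 (h ▸ hp)
  · exact fun h => hb₂.2.1 (h ▸ hp)

/-- `K₃,₃` minus an edge, hanging on at the ends of the missing edge, is reducible. -/
lemma isReducible_of_common_neighbour (hW : G.IsUnexceptional W) {l b₃ b₁ b₂ p z : V}
    (P : G.IsK23Pattern l b₃ b₁ b₂ p) (h12 : ¬ G.Adj b₁ b₂) (h1p : ¬ G.Adj b₁ p)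
    (h2p : ¬ G.Adj b₂ p) (hz1 : G.Adj b₁ z) (hz2 : G.Adj b₂ z) (hzl : z ≠ l) (hz3 : z ≠ b₃) :
    G.IsReducible W := by
  have hN1 : ∀ u, G.Adj b₁ u → u = l ∨ u = b₃ ∨ u = z := fun u hu =>
    hW.eq_of_adj P.ne_xy hzl.symm hz3.symm P.xp.symm P.yp.symm hz1 hu
  have hN2 : ∀ u, G.Adj b₂ u → u = l ∨ u = b₃ ∨ u = z := fun u hu =>
    hW.eq_of_adj P.ne_xy hzl.symm hz3.symm P.xq.symm P.yq.symm hz2 hu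
  have hzl' : ¬ G.Adj l z := fun h => by
    rcases P.adj_x hW h with rfl | rfl | rfl
    · exact G.irrefl hz1
    · exact G.irrefl hz2
    · exact h1p hz1
  have hz3' : ¬ G.Adj b₃ z := fun h => by
    rcases P.adj_y hW h with rfl | rfl | rfl
    · exact G.irrefl hz1
    · exact G.irrefl hz2
    · exact h1p hz1
  have hl3 : ¬ G.Adj l b₃ := fun h => by
    rcases P.adj_x hW h with h | h | h
    · exact P.yp.ne h
    · exact P.yq.ne h
    · exact P.yr.ne h
  by_cases hzp : G.Adj z p
  · exfalso
    have hNp : ∀ u, G.Adj p u → u = l ∨ u = b₃ ∨ u = z := fun u hu =>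
      hW.eq_of_adj P.ne_xy hzl.symm hz3.symm P.xr.symm P.yr.symm hzp.symm hu
    have hNz : ∀ u, G.Adj z u → u = b₁ ∨ u = b₂ ∨ u = p := fun u hu =>
      hW.eq_of_adj P.ne_pq P.ne_pr P.ne_qr hz1.symm hz2.symm hzp hu
    have hWeq : ({l, b₃, z, b₁, b₂, p} : Finset V) = W := by
      refine hW.conn _ (hW.subset_of_forall_adj fun u hu => ?_) ⟨l, by simp⟩ fun u hu w huw => ?_
      · simp only [Finset.mem_insert, Finset.mem_singleton] at hu
        rcases hu with rfl | rfl | rfl | rfl | rfl | rfl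
        · exact ⟨_, P.xp⟩
        · exact ⟨_, P.yp⟩
        · exact ⟨_, hzp⟩
        · exact ⟨_, hz1⟩
        · exact ⟨_, hz2⟩
        · exact ⟨_, hzp.symm⟩
      · simp only [Finset.mem_insert, Finset.mem_singleton] at hu ⊢
        rcases hu with rfl | rfl | rfl | rfl | rfl | rfl
        · have := P.adj_x hW huw
          tauto
        · have := P.adj_y hW huw
          tauto
        · have := hNz w huw
          tauto
        · have := hN1 w huw
          tauto
        · have := hN2 w huw
          tauto
        · have := hNp w huw
          tauto
    exact hW.not_exceptional (Or.inr (Or.inr (Or.inr ⟨l, b₃, z, b₁, b₂, p,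
      ⟨P, hzl.symm, hz3.symm, hz1.symm, hz2.symm, hzp⟩, hWeq.symm, hl3, hzl', hz3', h12, h1p,
      h2p⟩)))
  -- A tree containing the induced path `p l b₁ z` omits `b₃` and `b₂`, each closing a four-cycle,
  -- and both yield slack.
  · obtain ⟨T, hT, hmax⟩ := (isMatchedTree_path P.xr.symm P.xp hz1 (fun h => h1p h.symm)
      (fun h => hzp h.symm) hzl' P.ne_pr.symm (fun h => h1p (h ▸ hz1))
      hzl.symm).exists_isMaxMatchedTree (W := W) (by
        refine hW.subset_of_forall_adj fun u hu => ?_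
        simp only [Finset.mem_insert, Finset.mem_singleton] at hu
        rcases hu with rfl | rfl | rfl | rfl
        · exact ⟨_, P.xr.symm⟩
        · exact ⟨_, P.xr⟩
        · exact ⟨_, hz1⟩
        · exact ⟨_, hz1.symm⟩)
    have hpT : p ∈ T := hT (by simp)
    have hlT : l ∈ T := hT (by simp)
    have h1T : b₁ ∈ T := hT (by simp)
    have hzT : z ∈ T := hT (by simp)
    have h3T : b₃ ∉ T := hmax.forest.not_four_cycle h1T hlT hpT P.ne_pr P.ne_xy P.xp.symm P.xr
      P.yr.symm P.yp
    have h2T : b₂ ∉ T := hmax.forest.not_four_cycle hlT h1T hzT hzl.symm P.ne_pq P.xp hz1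
      hz2.symm P.xq.symm
    have hs3 := hW.one_le_slackAt h3T
      (two_le_degIn.2 ⟨p, hpT, b₁, h1T, P.ne_pr.symm, P.yr, P.yp⟩) (fun u hu => by
        rcases P.adj_y hW hu with rfl | rfl | rfl
        · exact Or.inl h1T
        · exact Or.inr (degIn_pos.2 ⟨l, hlT, P.xq.symm⟩)
        · exact Or.inl hpT)
    have hs2 := hW.one_le_slackAt h2T
      (two_le_degIn.2 ⟨l, hlT, z, hzT, hzl.symm, P.xq.symm, hz2⟩) (fun u hu => by
        rcases hN2 u hu with rfl | rfl | rfl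
        · exact Or.inl hlT
        · exact Or.inr (degIn_pos.2 ⟨p, hpT, P.yr⟩)
        · exact Or.inl hzT)
    have := two_le_slack hs3 hs2 P.yq.ne
    exact hmax.toIsStuck.isReducible_of_two_le hW (by omega)

/-- A path through two branches of a `K₂,₃` gives a gain of one. -/
lemma IsMaxMatchedTree.one_le_slack_of_isK23Pattern (hW : G.IsUnexceptional W) {T : Finset V}
    (h : G.IsMaxMatchedTree W T) {l b₃ b₁ b₂ p : V} (P : G.IsK23Pattern l b₃ b₁ b₂ p)
    (hl : l ∈ T) (h1 : b₁ ∈ T) (h2 : b₂ ∈ T) : 1 ≤ G.slack W T := by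
  have h3T : b₃ ∉ T := h.forest.not_four_cycle h1 hl h2 P.ne_pq P.ne_xy P.xp.symm P.xq
    P.yq.symm P.yp
  refine one_le_slack (hW.one_le_slackAt h3T
    (two_le_degIn.2 ⟨b₁, h1, b₂, h2, P.ne_pq, P.yp, P.yq⟩) (fun u hu => ?_))
  rcases P.adj_y hW hu with rfl | rfl | rfl
  · exact Or.inl h1
  · exact Or.inl h2
  · exact Or.inr (degIn_pos.2 ⟨l, hl, P.xr.symm⟩)

/-- Every connected subcubic graph that is not exceptional is reducible. -/
theorem IsUnexceptional.isReducible (hW : G.IsUnexceptional W) : G.IsReducible W := by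
  by_contra hred
  have hdeg : ∀ v ∈ W, 2 ≤ G.degIn W v := fun v hv => by
    by_contra! h
    exact hred (isReducible_of_degIn_le_one hW hv (by omega))
  have hK23 : ∀ x y p q r, G.IsK23Pattern x y p q r → 2 < G.degIn W r := by
    intro x y p q r h
    by_contra! hr
    exact hred (isReducible_of_isK23Pattern hW h hr)
  have hK4 : ∀ a b c d s, ¬ G.IsK4PlusPattern a b c d s := fun a b c d s h =>
    hred (isReducible_of_isK4PlusPattern hW h)
  -- For odd `|W|` the graph cannot be cubic, by the handshake lemma.
  obtain ⟨v, hvW, hv⟩ : ∃ v ∈ W, W.card % 2 = 1 → G.degIn W v ≤ 2 := by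
    by_cases hex : ∃ v ∈ W, G.degIn W v ≤ 2
    · obtain ⟨v, h1, h2⟩ := hex
      exact ⟨v, h1, fun _ => h2⟩
    · push Not at hex
      obtain ⟨v, h1⟩ := hW.nonempty
      refine ⟨v, h1, fun h2 => ?_⟩
      have h3 : ∑ u ∈ W, G.degIn W u = W.card * 3 :=
        Finset.sum_const_nat fun u hu => le_antisymm (hW.degIn_le u) (hex u hu)
      have h4 := even_sum_degIn G W
      rw [h3] at h4
      obtain ⟨k, hk⟩ := h4
      omega
  obtain ⟨u, -, hvu⟩ := degIn_pos.1 (lt_of_lt_of_le zero_lt_two (hdeg v hvW))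
  obtain ⟨T, hT, hmax⟩ := (isMatchedTree_pair hvu).exists_isMaxMatchedTree (W := W)
    (Finset.insert_subset hvW (Finset.singleton_subset_iff.2 (hW.mem hvu)))
  have hvT : v ∈ T := hT (by simp)
  -- The first of the two units, from parity or from `v`, for any tree through `v`.
  have hlow : ∀ T', v ∈ T' → 1 ≤ G.deficit W T' + (1 - W.card % 2) := fun T' hvT' => by
    have := le_deficit (G := G) (W := W) hvT'
    omega
  have hsmall : G.deficit W T + G.slack W T + (1 - W.card % 2) ≤ 1 := by
    by_contra! h
    exact hred (hmax.toIsStuck.isReducible_of_two_le hW (by omega))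
  -- Far vertices would supply the second unit by `sum_loss_lt`.
  have hfar : G.far W T = ∅ := by
    by_contra hne
    refine hred (hmax.toIsStuck.isReducible hW fun 𝒳 h𝒳 => ?_)
    have h1 := h𝒳.sum_loss_lt hW hmax.subset hmax.nonempty
      (Finset.nonempty_iff_ne_empty.2 hne) hdeg hK23 hK4
    have h2 := hlow T hvT
    omega
  have hlowT := hlow T hvT
  obtain ⟨hone, l, hl, p, hp, b₁, b₂, b₃, hb₁, hb₂, hb₃, P, hm, hadj⟩ :=
    hmax.exists_isK23Pattern hW hfar (by omega) (by omega)
  have h12 : ¬ G.Adj b₁ b₂ := fun h => hK4 _ _ _ _ _ (P.isK4PlusPattern h)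
  have h1p : ¬ G.Adj b₁ p := fun h => hK4 _ _ _ _ _ (P.rotate.rotate.isK4PlusPattern h.symm)
  have h2p : ¬ G.Adj b₂ p := fun h => hK4 _ _ _ _ _ (P.rotate.isK4PlusPattern h)
  obtain ⟨z₁, -, hz₁, hz₁l, hz₁3⟩ := exists_of_two_lt_degIn (hK23 _ _ _ _ _ P.rotate) l b₃
  obtain ⟨z₂, -, hz₂, hz₂l, hz₂3⟩ := exists_of_two_lt_degIn (hK23 _ _ _ _ _ P.rotate.rotate) l b₃
  obtain ⟨q, -, hq, hql, hq3⟩ := exists_of_two_lt_degIn (hK23 _ _ _ _ _ P) l b₃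
  have hzz : z₁ ≠ z₂ := by
    rintro rfl
    exact hred (isReducible_of_common_neighbour hW P h12 h1p h2p hz₁ hz₂ hz₁l hz₁3)
  have hN1 : ∀ u, G.Adj b₁ u → u = l ∨ u = b₃ ∨ u = z₁ := fun u hu =>
    hW.eq_of_adj P.ne_xy hz₁l.symm hz₁3.symm P.xp.symm P.yp.symm hz₁ hu
  have hN2 : ∀ u, G.Adj b₂ u → u = l ∨ u = b₃ ∨ u = z₂ := fun u hu =>
    hW.eq_of_adj P.ne_xy hz₂l.symm hz₂3.symm P.xq.symm P.yq.symm hz₂ hu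
  have hNp : ∀ u, G.Adj p u → u = l ∨ u = b₃ ∨ u = q := fun u hu =>
    hW.eq_of_adj P.ne_xy hql.symm hq3.symm P.xr.symm P.yr.symm hq hu
  have hz₁b₂ : z₁ ≠ b₂ := fun h => h12 (h ▸ hz₁)
  have hlz₁ : ¬ G.Adj l z₁ := fun h => by
    rcases P.adj_x hW h with h | h | h
    · exact hz₁.ne' h
    · exact hz₁b₂ h
    · exact h1p (h ▸ hz₁)
  have hz₁b₂' : ¬ G.Adj z₁ b₂ := fun h => by
    rcases hN2 _ h.symm with h | h | h
    · exact hz₁l h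
    · exact hz₁3 h
    · exact hzz h
  -- A tree through `b₁`, `l`, `b₂` has slack one at `b₃`. For odd `|W|` it must also contain `v`,
  -- so it is obtained by rebuilding `T` near `l p`.
  by_cases hpar : W.card % 2 = 1
  · have hv3 := hv hpar
    have hvl : v ≠ l := by
      rintro rfl
      have := three_le_degIn (hW.mem P.xp) (hW.mem P.xq) (hW.mem P.xr) P.ne_pq P.ne_pr P.ne_qr
        P.xp P.xq P.xr
      omega
    have hvp : v ≠ p := by
      rintro rfl
      have := hK23 _ _ _ _ _ P
      omega
    have honly : ∀ b t, b ∈ W → b ∉ T → t ∈ T → G.Adj b t → ∀ u ∈ T, G.Adj b u → u = t := by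
      intro b t hbW hb ht hbt u hu hbu
      obtain ⟨a, -, -, ha⟩ := degIn_eq_one.1 (hone b hbW hb)
      rw [ha t ht hbt, ha u hu hbu]
    have honly₁ := honly b₁ l (hW.mem P.xp) hb₁ hl P.xp.symm
    have honly₂ := honly b₂ l (hW.mem P.xq) hb₂ hl P.xq.symm
    have hz₁T : z₁ ∉ T := fun h => hz₁l (honly₁ z₁ h hz₁)
    have hz₂T : z₂ ∉ T := fun h => hz₂l (honly₂ z₂ h hz₂)
    -- Outside `T`, `q` would be adjacent to both `b₁` and `b₂` by `hadj`, forcing `q = z₁ = z₂`.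
    have hqT : q ∈ T := by
      by_contra hqT
      have e1 : q = z₁ := by
        have h1 := hadj b₁ q hb₁ hqT P.xp.symm hq.symm (fun h => h1p (h ▸ hq.symm))
        rcases hN1 q h1 with h | h | h
        · exact absurd h hql
        · exact absurd h hq3
        · exact h
      have e2 : q = z₂ := by
        have h1 := hadj b₂ q hb₂ hqT P.xq.symm hq.symm (fun h => h2p (h ▸ hq.symm))
        rcases hN2 q h1 with h | h | h
        · exact absurd h hql
        · exact absurd h hq3
        · exact h
      exact hzz (e1.symm.trans e2)
    have hpz₁ : ¬ G.Adj p z₁ := fun h => by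
      rcases hNp _ h with h | h | h
      · exact hz₁l h
      · exact hz₁3 h
      · exact hz₁T (h ▸ hqT)
    -- In `T`, `l` is a leaf attached to `p`, and `p` has just one other neighbour, `q`; removing
    -- the pair leaves a matched tree.
    have hT₁ : G.IsMatchedTree (T \ {l, p}) := by
      refine ⟨?_, hm⟩
      have h1 : G.IsTreeOn (T.erase l) := hmax.toIsTreeOn.erase hl
        (degIn_eq_one.2 ⟨p, hp, P.xr, fun u hu hlu => by
          rcases P.adj_x hW hlu with rfl | rfl | rfl
          · exact absurd hu hb₁
          · exact absurd hu hb₂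
          · rfl⟩)
      have h2 := h1.erase (v := p) (Finset.mem_erase.2 ⟨P.xr.ne', hp⟩)
        (degIn_eq_one.2 ⟨q, Finset.mem_erase.2 ⟨hql, hqT⟩, hq, fun u hu hpu => by
          rw [Finset.mem_erase] at hu
          rcases hNp u hpu with rfl | rfl | rfl
          · exact absurd rfl hu.1
          · exact absurd hu.2 hb₃
          · rfl⟩)
      convert h2 using 1
      ext u
      simp only [Finset.mem_sdiff, Finset.mem_insert, Finset.mem_singleton, Finset.mem_erase]
      tauto
    -- The unique neighbour of `z₁` in `T` is neither `l` nor `p`, so `z₁` can be attached with leaf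
    -- `b₁`; next `l` is attached to `b₁` with leaf `b₂`.
    have hT₂ := hT₁.insert_insert (b := z₁) (x := b₁) (by simp [hz₁T]) (by
      obtain ⟨t, ht, hzt, htu⟩ := degIn_eq_one.1 (hone z₁ (hW.mem hz₁) hz₁T)
      refine degIn_eq_one.2 ⟨t, ?_, hzt, fun u hu => htu u (Finset.mem_sdiff.1 hu).1⟩
      simp only [Finset.mem_sdiff, Finset.mem_insert, Finset.mem_singleton, not_or]
      exact ⟨ht, fun h => hlz₁ (h ▸ hzt.symm), fun h => hpz₁ (h ▸ hzt.symm)⟩) (by simp [hb₁]) (by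
      rw [degIn_eq_zero]
      intro u hu h1u
      rw [Finset.mem_sdiff] at hu
      exact hu.2 (by simp [honly₁ u hu.1 h1u])) hz₁
    have hT₃ := hT₂.insert_insert (b := l) (x := b₂) (by simp [P.xp.ne, hz₁l.symm]) (by
      refine degIn_eq_one.2 ⟨b₁, by simp, P.xp, fun u hu hlu => ?_⟩
      rcases P.adj_x hW hlu with rfl | rfl | rfl
      · rfl
      · simp [P.ne_pq.symm, hz₁b₂.symm, hb₂] at hu
      · simp only [Finset.mem_insert, Finset.mem_sdiff, Finset.mem_singleton] at hu
        rcases hu with h | h | h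
        · exact h
        · exact absurd (h ▸ hlu) hlz₁
        · tauto) (by simp [P.ne_pq.symm, hz₁b₂.symm, hb₂]) (by
      rw [degIn_eq_zero]
      intro u hu h2u
      simp only [Finset.mem_insert, Finset.mem_sdiff, Finset.mem_singleton] at hu
      rcases hu with rfl | rfl | h
      · exact h12 h2u.symm
      · exact hz₁b₂' h2u.symm
      · exact h.2 (Or.inl (honly₂ u h.1 h2u))) P.xq.symm
    obtain ⟨T', hT', hmax'⟩ := hT₃.exists_isMaxMatchedTree (W := W) (by
      refine Finset.insert_subset (hW.mem P.xq) (Finset.insert_subset (hW.mem P.xp.symm)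
        (Finset.insert_subset (hW.mem P.xp) (Finset.insert_subset (hW.mem hz₁)
        (Finset.sdiff_subset.trans hmax.subset)))))
    have hs := hmax'.one_le_slack_of_isK23Pattern hW P (hT' (by simp)) (hT' (by simp))
      (hT' (by simp))
    have hd := hlow T' (hT' (by simp [hvl, hvp, hvT]))
    exact hred (hmax'.toIsStuck.isReducible_of_two_le hW (by omega))
  -- For even `|W|` parity is the first unit, so the tree may start afresh from `z₁ b₁ l b₂`.
  · obtain ⟨T', hT', hmax'⟩ := (isMatchedTree_path hz₁.symm P.xp.symm P.xq
      (fun h => hlz₁ h.symm) hz₁b₂' h12 hz₁l hz₁b₂ P.ne_pq).exists_isMaxMatchedTree (W := W) (by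
        refine hW.subset_of_forall_adj fun u hu => ?_
        simp only [Finset.mem_insert, Finset.mem_singleton] at hu
        rcases hu with rfl | rfl | rfl | rfl
        · exact ⟨_, hz₁.symm⟩
        · exact ⟨_, hz₁⟩
        · exact ⟨_, P.xr⟩
        · exact ⟨_, P.xq.symm⟩)
    have hs := hmax'.one_le_slack_of_isK23Pattern hW P (hT' (by simp)) (hT' (by simp))
      (hT' (by simp))
    exact hred (hmax'.toIsStuck.isReducible_of_two_le hW (by omega))

end
-- Induction over vertex sets
section
variable {V : Type*} {G H : SimpleGraph V} [DecidableEq V] {W : Finset V}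

lemma InducesK23.congr {X : Finset V} (h : ∀ a ∈ X, ∀ b ∈ X, G.Adj a b ↔ H.Adj a b)
    (hX : G.InducesK23 X) : H.InducesK23 X := by
  obtain ⟨x, y, p, q, r, P, rfl, hX⟩ := hX
  have hx := h x (by simp)
  have hy := h y (by simp)
  have hp := h p (by simp)
  have hq := h q (by simp)
  rw [hx y (by simp), hp q (by simp), hp r (by simp), hq r (by simp)] at hX
  exact ⟨x, y, p, q, r, ⟨P.ne_xy, P.ne_pq, P.ne_pr, P.ne_qr, (hx p (by simp)).1 P.xp,
    (hx q (by simp)).1 P.xq, (hx r (by simp)).1 P.xr, (hy p (by simp)).1 P.yp,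
    (hy q (by simp)).1 P.yq, (hy r (by simp)).1 P.yr⟩, rfl, hX⟩

lemma InducesK4Plus.congr {X : Finset V} (h : ∀ a ∈ X, ∀ b ∈ X, G.Adj a b ↔ H.Adj a b)
    (hX : G.InducesK4Plus X) : H.InducesK4Plus X := by
  obtain ⟨a, b, c, d, s, P, rfl, hX⟩ := hX
  have ha := h a (by simp)
  have hb := h b (by simp)
  have hc := h c (by simp)
  have hs := h s (by simp)
  rw [ha b (by simp), hs c (by simp), hs d (by simp)] at hX
  exact ⟨a, b, c, d, s, ⟨P.ne_ab, P.ne_sc, P.ne_sd, (hc d (by simp)).1 P.cd,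
    (ha c (by simp)).1 P.ac, (ha d (by simp)).1 P.ad, (hb c (by simp)).1 P.bc,
    (hb d (by simp)).1 P.bd, (hs a (by simp)).1 P.sa, (hs b (by simp)).1 P.sb⟩, rfl, hX⟩

lemma InducesK33.congr {X : Finset V} (h : ∀ a ∈ X, ∀ b ∈ X, G.Adj a b ↔ H.Adj a b)
    (hX : G.InducesK33 X) : H.InducesK33 X := by
  obtain ⟨x, y, z, p, q, r, P, rfl, hX⟩ := hX
  have hx := h x (by simp)
  have hy := h y (by simp)
  have hz := h z (by simp)
  have hp := h p (by simp)
  have hq := h q (by simp)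
  rw [hx y (by simp), hx z (by simp), hy z (by simp), hp q (by simp), hp r (by simp),
    hq r (by simp)] at hX
  exact ⟨x, y, z, p, q, r, ⟨⟨P.ne_xy, P.ne_pq, P.ne_pr, P.ne_qr, (hx p (by simp)).1 P.xp,
    (hx q (by simp)).1 P.xq, (hx r (by simp)).1 P.xr, (hy p (by simp)).1 P.yp,
    (hy q (by simp)).1 P.yq, (hy r (by simp)).1 P.yr⟩, P.ne_xz, P.ne_yz, (hz p (by simp)).1 P.zp,
    (hz q (by simp)).1 P.zq, (hz r (by simp)).1 P.zr⟩, rfl, hX⟩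

lemma IsExceptional.congr {X : Finset V} (h : ∀ a ∈ X, ∀ b ∈ X, G.Adj a b ↔ H.Adj a b)
    (hX : G.IsExceptional X) : H.IsExceptional X :=
  hX.imp_right (Or.imp (InducesK23.congr h) (Or.imp (InducesK4Plus.congr h) (InducesK33.congr h)))

lemma loss_congr {X : Finset V} (h : ∀ a ∈ X, ∀ b ∈ X, G.Adj a b ↔ H.Adj a b) :
    G.loss X = H.loss X := by
  unfold loss
  have : G.InducesK33 X ↔ H.InducesK33 X :=
    ⟨InducesK33.congr h, InducesK33.congr fun a ha b hb => (h a ha b hb).symm⟩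
  by_cases h33 : G.InducesK33 X
  · rw [if_pos h33, if_pos (this.1 h33)]
  · rw [if_neg h33, if_neg fun h' => h33 (this.2 h')]

omit [DecidableEq V] in
lemma IsForestOn.congr {U : Finset V} (h : ∀ a ∈ U, ∀ b ∈ U, G.Adj a b ↔ H.Adj a b)
    (hU : G.IsForestOn U) : H.IsForestOn U := by
  intro A hA hne
  obtain ⟨v, hv, hd⟩ := hU A hA hne
  refine ⟨v, hv, le_of_eq_of_le ?_ hd⟩
  unfold degIn
  congr 1
  ext u
  simp only [mem_nbrIn, and_congr_right_iff]
  exact fun hu => (h v (hA hv) u (hA hu)).symm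

omit [DecidableEq V] in
lemma IsMating.congr {U : Finset V} {f : V → V} (h : ∀ a ∈ U, ∀ b ∈ U, G.Adj a b ↔ H.Adj a b)
    (hU : G.IsMating f U) : H.IsMating f U := fun v hv =>
  ⟨(hU v hv).1, (h v hv _ (hU v hv).1).1 (hU v hv).2.1, (hU v hv).2.2⟩

/-- The graph obtained from `G` by deleting all edges not inside `W`. -/
def restrict (G : SimpleGraph V) (W : Finset V) : SimpleGraph V where
  Adj a b := G.Adj a b ∧ a ∈ W ∧ b ∈ W
  symm := ⟨fun _ _ h => ⟨h.1.symm, h.2.2, h.2.1⟩⟩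
  loopless := ⟨fun _ h => G.irrefl h.1⟩

omit [DecidableEq V] in
lemma restrict_adj_iff {X : Finset V} (hX : X ⊆ W) :
    ∀ a ∈ X, ∀ b ∈ X, G.Adj a b ↔ (G.restrict W).Adj a b :=
  fun _ ha _ hb => ⟨fun h => ⟨h, hX ha, hX hb⟩, fun h => h.1⟩

/-- A matched forest in `W` that is large up to the exceptional components. -/
def HasLargeMatching (G : SimpleGraph V) (W : Finset V) : Prop :=
  ∃ S ⊆ W, G.IsForestOn S ∧ G.HasMating S ∧ ∃ 𝒳, G.IsExceptionalFamily W 𝒳 ∧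
    W.card ≤ 2 * S.card + ∑ X ∈ 𝒳, G.loss X

/-- A single edge accounts for four vertices and the loss for the rest: one of five, or two of six.
A lone vertex is covered by its loss alone. -/
lemma IsExceptional.hasLargeMatching (h : G.IsExceptional W) : G.HasLargeMatching W := by
  have hfam : G.IsExceptionalFamily W {W} := by
    refine ⟨by simp, by simpa, fun X hX x _ y hy _ => ?_, fun X hX Y hY hne => ?_⟩
    · rwa [Finset.mem_singleton.1 hX]
    · rw [Finset.mem_singleton] at hX hY
      exact absurd (hX.trans hY.symm) hne
  have hloss : 1 ≤ G.loss W := by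
    unfold loss
    split_ifs <;> norm_num
  have hpair : ∀ a b, a ∈ W → b ∈ W → G.Adj a b → W.card ≤ 4 + G.loss W →
      G.HasLargeMatching W := by
    intro a b ha hb hab hle
    refine ⟨{a, b}, Finset.insert_subset ha (Finset.singleton_subset_iff.2 hb),
      (isMatchedTree_pair hab).forest, hasMating_pair hab, {W}, hfam, ?_⟩
    rw [Finset.sum_singleton, Finset.card_pair hab.ne]
    exact hle
  rcases h with ⟨v, rfl⟩ | ⟨x, y, p, q, r, P, hXe, -⟩ | ⟨a, b, c, d, s, P, hXe, -⟩ | h33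
  · refine ⟨∅, by simp, fun A hA hne => ?_, hasMating_empty, _, hfam, by simpa⟩
    exact absurd (Finset.subset_empty.1 hA) hne.ne_empty
  · have := Finset.card_le_five (a := x) (b := y) (c := p) (d := q) (e := r)
    rw [← hXe] at this
    exact hpair x p (by simp [hXe]) (by simp [hXe]) P.xp (by omega)
  · have := Finset.card_le_five (a := a) (b := b) (c := c) (d := d) (e := s)
    rw [← hXe] at this
    exact hpair c d (by simp [hXe]) (by simp [hXe]) P.cd (by omega)
  · have hl : G.loss W = 2 := if_pos h33
    obtain ⟨x, y, z, p, q, r, P, hXe, -⟩ := h33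
    have := Finset.card_le_six (a := x) (b := y) (c := z) (d := p) (e := q) (f := r)
    rw [← hXe] at this
    exact hpair x p (by simp [hXe]) (by simp [hXe]) P.xp (by omega)

lemma HasLargeMatching.union {A B : Finset V} (hA : G.HasLargeMatching A)
    (hB : G.HasLargeMatching B) (hdis : Disjoint A B) (h : ∀ a ∈ A, ∀ b ∈ B, ¬ G.Adj a b) :
    G.HasLargeMatching (A ∪ B) := by
  obtain ⟨S, hS, hSf, hSm, 𝒳, h𝒳, hle⟩ := hA
  obtain ⟨S', hS', hSf', hSm', 𝒳', h𝒳', hle'⟩ := hB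
  have hSS : Disjoint S S' := Finset.disjoint_of_subset_left hS
    (Finset.disjoint_of_subset_right hS' hdis)
  have hXX : ∀ X ∈ 𝒳, ∀ Y ∈ 𝒳', Disjoint X Y := fun X hX Y hY =>
    Finset.disjoint_of_subset_left (h𝒳.subset X hX)
      (Finset.disjoint_of_subset_right (h𝒳'.subset Y hY) hdis)
  refine ⟨S ∪ S', Finset.union_subset_union hS hS',
    hSf.union hSf' fun a ha b hb => h a (hS ha) b (hS' hb), hSm.union hSm' hSS, 𝒳 ∪ 𝒳',
    ⟨?_, ?_, ?_, ?_⟩, ?_⟩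
  · intro X hX
    rcases Finset.mem_union.1 hX with hX | hX
    · exact (h𝒳.subset X hX).trans Finset.subset_union_left
    · exact (h𝒳'.subset X hX).trans Finset.subset_union_right
  · intro X hX
    rcases Finset.mem_union.1 hX with hX | hX
    · exact h𝒳.exceptional X hX
    · exact h𝒳'.exceptional X hX
  · intro X hX x hx y hy hxy
    rcases Finset.mem_union.1 hX with hX | hX <;> rcases Finset.mem_union.1 hy with hy | hy
    · exact h𝒳.closed X hX x hx y hy hxy
    · exact absurd hxy (h x (h𝒳.subset X hX hx) y hy)
    · exact absurd hxy.symm (h y hy x (h𝒳'.subset X hX hx))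
    · exact h𝒳'.closed X hX x hx y hy hxy
  · intro X hX Y hY hne
    rcases Finset.mem_union.1 hX with hX | hX <;> rcases Finset.mem_union.1 hY with hY | hY
    · exact h𝒳.disjoint X hX Y hY hne
    · exact hXX X hX Y hY
    · exact (hXX Y hY X hX).symm
    · exact h𝒳'.disjoint X hX Y hY hne
  · rw [Finset.sum_union, Finset.card_union_of_disjoint hdis, Finset.card_union_of_disjoint hSS]
    · omega
    · rw [Finset.disjoint_left]
      intro X hX hX'
      have h1 := hXX X hX X hX'
      rw [disjoint_self, Finset.bot_eq_empty] at h1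
      exact (h𝒳.exceptional X hX).nonempty.ne_empty h1

/-- Every finite vertex set in a subcubic graph has a large matched forest. -/
theorem hasLargeMatching (hcubic : ∀ (U : Finset V) (v : V), G.degIn U v ≤ 3) (W : Finset V) :
    G.HasLargeMatching W := by
  induction W using Finset.strongInduction with
  | H W ih =>
  by_cases hne : W.Nonempty
  swap
  · rw [Finset.not_nonempty_iff_eq_empty] at hne
    subst hne
    exact ⟨∅, subset_rfl, fun A hA hne => absurd (Finset.subset_empty.1 hA) hne.ne_empty,
      hasMating_empty, ∅, ⟨by simp, by simp, by simp, by simp⟩, by simp⟩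
  by_cases hexc : G.IsExceptional W
  · exact hexc.hasLargeMatching
  by_cases hsplit : ∃ X ⊆ W, X.Nonempty ∧ (∀ x ∈ X, ∀ y ∈ W, G.Adj x y → y ∈ X) ∧ X ≠ W
  · obtain ⟨X, hX, hXne, hcl, hXW⟩ := hsplit
    have h1 := ih X (Finset.ssubset_iff_subset_ne.2 ⟨hX, hXW⟩)
    have h2 := ih (W \ X) (Finset.sdiff_ssubset hX hXne)
    have h3 := h1.union h2 Finset.disjoint_sdiff fun a ha b hb hab =>
      (Finset.mem_sdiff.1 hb).2 (hcl a ha b (Finset.mem_sdiff.1 hb).1 hab)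
    rwa [Finset.union_sdiff_of_subset hX] at h3
  push Not at hsplit
  -- Restricting puts every edge inside `W`, so connectedness of `W` is stated without reference to
  -- the rest of `G`.
  have hW : (G.restrict W).IsUnexceptional W := by
    refine ⟨fun a b h => h.2.2, fun v => le_trans ?_ (hcubic W v), fun X hX hXne hcl => ?_, hne,
      fun h => hexc (h.congr fun a ha b hb => (restrict_adj_iff subset_rfl a ha b hb).symm)⟩
    · refine Finset.card_le_card fun u hu => ?_
      rw [mem_nbrIn] at hu ⊢
      exact ⟨hu.1, hu.2.1⟩
    · exact hsplit X hX hXne fun x hx y hy hxy => hcl x hx y ⟨hxy, hX hx, hy⟩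
  obtain ⟨T, hT, hTne, hTf, ⟨f, hf⟩, C, hC, hTC, hadj, hsum⟩ := hW.isReducible
  have hCW : C ⊂ W := by
    refine Finset.ssubset_iff_subset_ne.2 ⟨hC, ?_⟩
    rintro rfl
    obtain ⟨t, ht⟩ := hTne
    exact Finset.disjoint_left.1 hTC ht (hT ht)
  obtain ⟨S, hS, hSf, hSm, 𝒳, h𝒳, hle⟩ := ih C hCW
  have hsymm : ∀ a ∈ T, ∀ b ∈ T, (G.restrict W).Adj a b ↔ G.Adj a b := fun a ha b hb =>
    (restrict_adj_iff hT a ha b hb).symm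
  have hTS : Disjoint T S := Finset.disjoint_of_subset_right hS hTC
  have hsub : ∀ X ∈ 𝒳, X ⊆ W := fun X hX => (h𝒳.subset X hX).trans hC
  have h1 := hsum 𝒳 ⟨h𝒳.subset, fun X hX => (h𝒳.exceptional X hX).congr
    (restrict_adj_iff (hsub X hX)), fun X hX x hx y hy hxy => h𝒳.closed X hX x hx y hy hxy.1,
    h𝒳.disjoint⟩
  rw [Finset.sum_congr rfl fun X hX => (loss_congr (restrict_adj_iff (hsub X hX))).symm] at h1
  refine ⟨T ∪ S, Finset.union_subset hT (hS.trans hC),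
    (hTf.congr hsymm).union hSf fun a ha b hb hab =>
      hadj a ha b (hS hb) ⟨hab, hT ha, hC (hS hb)⟩,
    HasMating.union ⟨f, hf.congr hsymm⟩ hSm hTS, ∅, ⟨by simp, by simp, by simp, by simp⟩, ?_⟩
  -- The losses in `C` cancel, leaving `|W| ≤ 2(|T| + |S|) + (1 - |W| % 2)`; for even `|W|` the
  -- extra 1 drops out by parity.
  rw [Finset.sum_empty, Finset.card_union_of_disjoint hTS]
  omega

end

/-! ### From matched forests to acyclic matchings, and from exceptional sets to components -/

section
variable {V : Type*} {G : SimpleGraph V}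

/-- The vertex set of a cycle would be a nonempty subset in which every vertex has two neighbours.
-/
lemma IsForestOn.isAcyclic_induce [DecidableEq V] {S : Finset V} (h : G.IsForestOn S) :
    (G.induce (S : Set V)).IsAcyclic := by
  intro w c hc
  obtain ⟨v, hv, hd⟩ := h (c.support.toFinset.image Subtype.val) (by
    intro u hu
    obtain ⟨a, -, rfl⟩ := Finset.mem_image.1 hu
    exact a.2) ⟨w, by simp⟩
  obtain ⟨a, ha, rfl⟩ := Finset.mem_image.1 hv
  obtain ⟨x, y, hxy, hN⟩ := Set.ncard_eq_two.1
    (hc.ncard_neighborSet_toSubgraph_eq_two (List.mem_toFinset.1 ha))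
  have hmem : ∀ z ∈ c.toSubgraph.neighborSet a,
      (z : V) ∈ c.support.toFinset.image Subtype.val ∧ G.Adj a z := by
    intro z hz
    rw [Subgraph.mem_neighborSet] at hz
    refine ⟨Finset.mem_image.2 ⟨z, ?_, rfl⟩, hz.adj_sub⟩
    rw [List.mem_toFinset, ← Walk.mem_verts_toSubgraph]
    exact c.toSubgraph.edge_vert hz.symm
  obtain ⟨hx, hx'⟩ := hmem x (by simp [hN])
  obtain ⟨hy, hy'⟩ := hmem y (by simp [hN])
  have := two_le_degIn.2 ⟨(x : V), hx, (y : V), hy, fun h => hxy (Subtype.ext h), hx', hy'⟩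
  omega

/-- The subgraph whose edges are the pairs `v`, `f v` with `v ∈ S`. -/
def matingSubgraph {S : Finset V} {f : V → V} (hf : G.IsMating f S) : G.Subgraph where
  verts := S
  Adj a b := a ∈ S ∧ b = f a
  adj_sub := by
    rintro a b ⟨ha, rfl⟩
    exact (hf a ha).2.1
  edge_vert := fun h => h.1
  symm := ⟨by
    rintro a b ⟨ha, rfl⟩
    exact ⟨(hf a ha).1, (hf a ha).2.2.symm⟩⟩

lemma card_le_two_mul_acyclicMatchingNumber [Finite V] {S : Finset V} (hS : G.IsForestOn S)
    (hm : G.HasMating S) : S.card ≤ 2 * G.acyclicMatchingNumber := by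
  classical
  obtain ⟨f, hf⟩ := hm
  let M := matingSubgraph hf
  have hM : IsAcyclicMatching M := by
    refine ⟨fun v hv => ⟨f v, ⟨hv, rfl⟩, fun w hw => hw.2⟩, hS.isAcyclic_induce⟩
  have h1 := G.isGreatest_acyclicMatchingNumber.2 ⟨M, hM, rfl⟩
  -- Each edge `s(v, f v)` arises from at most its two ends.
  have h2 : S.card ≤ 2 * (S.image fun v => s(v, f v)).card := by
    refine Finset.card_le_mul_card_image S 2 fun e he => ?_
    obtain ⟨v, hv, rfl⟩ := Finset.mem_image.1 he
    refine le_trans (Finset.card_le_card (t := {v, f v}) fun u hu => ?_) Finset.card_le_two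
    have h3 := (Finset.mem_filter.1 hu).2
    rw [Sym2.eq_iff] at h3
    simp only [Finset.mem_insert, Finset.mem_singleton]
    tauto
  have h3 : (S.image fun v => s(v, f v)).card ≤ M.edgeSet.ncard := by
    rw [← Set.ncard_coe_finset]
    refine Set.ncard_le_ncard (fun e he => ?_) (Set.toFinite _)
    obtain ⟨v, hv, rfl⟩ := Finset.mem_image.1 (Finset.mem_coe.1 he)
    exact Subgraph.mem_edgeSet.2 ⟨hv, rfl⟩
  omega

lemma exists_component_of_closed {X : Finset V} {v : V} (hv : v ∈ X)
    (hcl : ∀ x ∈ X, ∀ y, G.Adj x y → y ∈ X) (hconn : ∀ x ∈ X, G.Reachable v x) :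
    (G.connectedComponentMk v).supp = X := by
  ext u
  rw [ConnectedComponent.mem_supp_iff, ConnectedComponent.eq, Finset.mem_coe]
  refine ⟨fun h => ?_, fun hu => (hconn u hu).symm⟩
  obtain ⟨w⟩ := h
  clear hconn
  induction w with
  | nil => exact hv
  | cons h w ih => exact hcl _ (ih hv) _ h.symm

lemma nonempty_iso_induce {U : Type*} {H : SimpleGraph U} {X : Set V} (g : U → V)
    (hg : Function.Injective g) (hX : Set.range g = X)
    (hadj : ∀ a b, G.Adj (g a) (g b) ↔ H.Adj a b) : Nonempty (G.induce X ≃g H) := by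
  subst hX
  exact ⟨(⟨Equiv.ofInjective g hg, by
    intro a b
    simp [hadj]⟩ : H ≃g G.induce (Set.range g)).symm⟩

lemma nonempty_iso_completeBipartiteGraph {A B : Type*} {X : Set V} (f : A → V) (g : B → V)
    (hf : Function.Injective f) (hg : Function.Injective g) (hX : Set.range f ∪ Set.range g = X)
    (hff : ∀ i j, ¬ G.Adj (f i) (f j)) (hgg : ∀ i j, ¬ G.Adj (g i) (g j))
    (hfg : ∀ i j, G.Adj (f i) (g j)) :
    Nonempty (G.induce X ≃g completeBipartiteGraph A B) := by
  refine nonempty_iso_induce (Sum.elim f g) (hf.sumElim hg fun i j => (hfg i j).ne)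
    (by rw [Set.Sum.elim_range, hX]) ?_
  rintro (i | i) (j | j)
  · simp [hff]
  · simp [hfg]
  · simp [(hfg j i).symm]
  · simp [hgg]

lemma injective_vec_three {a b c : V} (hab : a ≠ b) (hac : a ≠ c) (hbc : b ≠ c) :
    Function.Injective ![a, b, c] := by
  intro i j hij
  fin_cases i <;> fin_cases j <;> simp_all

lemma card_le_componentCount [Finite V] {U : Type*} {H : SimpleGraph U} (𝒳 : Finset (Finset V))
    (h : ∀ X ∈ 𝒳, ∃ c : G.ConnectedComponent, c.supp = X ∧ Nonempty (c.toSimpleGraph ≃g H)) :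
    𝒳.card ≤ G.componentCount H := by
  obtain rfl | ⟨X₀, hX₀⟩ := 𝒳.eq_empty_or_nonempty
  · exact Nat.zero_le _
  -- Supplies the default value that `choose!` needs outside `𝒳`.
  have : Nonempty G.ConnectedComponent := ⟨(h X₀ hX₀).choose⟩
  choose! c hc using h
  rw [← Set.ncard_coe_finset]
  refine Set.ncard_le_ncard_of_injOn c (fun X hX => (hc X hX).2) (fun X hX Y hY hXY => ?_)
    (Set.toFinite _)
  have h1 := (hc X hX).1
  rw [hXY, (hc Y hY).1] at h1
  exact Finset.coe_injective h1.symm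

variable [DecidableEq V]

lemma InducesK23.exists_component {X : Finset V} (h : G.InducesK23 X)
    (hcl : ∀ x ∈ X, ∀ y, G.Adj x y → y ∈ X) : ∃ c : G.ConnectedComponent, c.supp = X ∧
      Nonempty (c.toSimpleGraph ≃g completeBipartiteGraph (Fin 2) (Fin 3)) := by
  obtain ⟨x, y, p, q, r, P, hX, h1, h2, h3, h4⟩ := h
  have hs := exists_component_of_closed (v := x) (by simp [hX]) hcl (by
    intro u hu
    simp only [hX, Finset.mem_insert, Finset.mem_singleton] at hu
    rcases hu with rfl | rfl | rfl | rfl | rfl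
    · exact Reachable.refl _
    · exact P.xp.reachable.trans P.yp.symm.reachable
    · exact P.xp.reachable
    · exact P.xq.reachable
    · exact P.xr.reachable)
  refine ⟨_, hs, nonempty_iso_completeBipartiteGraph ![x, y] ![p, q, r] ?_
    (injective_vec_three P.ne_pq P.ne_pr P.ne_qr) ?_ ?_ ?_ ?_⟩
  · have := P.ne_xy
    intro i j hij
    fin_cases i <;> fin_cases j <;> simp_all
  · rw [hs, hX]
    ext u
    simp [eq_comm]
    tauto
  · simp [Fin.forall_fin_succ, h1, mt G.adj_symm h1]
  · simp [Fin.forall_fin_succ, h2, h3, h4, mt G.adj_symm h2, mt G.adj_symm h3, mt G.adj_symm h4]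
  · simp [Fin.forall_fin_succ, P.xp, P.xq, P.xr, P.yp, P.yq, P.yr]

lemma InducesK4Plus.exists_component {X : Finset V} (h : G.InducesK4Plus X)
    (hcl : ∀ x ∈ X, ∀ y, G.Adj x y → y ∈ X) : ∃ c : G.ConnectedComponent, c.supp = X ∧
      Nonempty (c.toSimpleGraph ≃g K4Plus) := by
  obtain ⟨a, b, c, d, s, P, hX, h1, h2, h3⟩ := h
  have hs := exists_component_of_closed (v := a) (by simp [hX]) hcl (by
    intro u hu
    simp only [hX, Finset.mem_insert, Finset.mem_singleton] at hu
    rcases hu with rfl | rfl | rfl | rfl | rfl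
    · exact Reachable.refl _
    · exact P.ac.reachable.trans P.bc.symm.reachable
    · exact P.ac.reachable
    · exact P.ad.reachable
    · exact P.sa.symm.reachable)
  refine ⟨_, hs, nonempty_iso_induce (fun o => o.elim s ![a, b, c, d]) ?_ ?_ ?_⟩
  · have := P.ne_ab; have := P.ne_sc; have := P.ne_sd; have := P.cd.ne
    have := P.ac.ne; have := P.ad.ne; have := P.bc.ne
    have := P.bd.ne; have := P.sa.ne; have := P.sb.ne
    rintro (_ | i) (_ | j) hij
    · rfl
    · fin_cases j <;> simp_all
    · fin_cases i <;> simp_all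
    · fin_cases i <;> fin_cases j <;> simp_all
  · rw [hs, hX]
    ext u
    simp [Option.exists, Fin.exists_fin_succ, eq_comm]
    tauto
  · have := P.cd
    have := P.ac; have := P.ad; have := P.bc
    have := P.bd; have := P.sa; have := P.sb
    rintro (_ | i) (_ | j)
    · simp [K4Plus, subdivideEdge]
    · fin_cases j <;> simp_all [K4Plus, subdivideEdge]
    · fin_cases i <;> simp_all [K4Plus, subdivideEdge, G.adj_comm]
    · fin_cases i <;> fin_cases j <;> simp_all [K4Plus, subdivideEdge, G.adj_comm]

lemma InducesK33.exists_component {X : Finset V} (h : G.InducesK33 X)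
    (hcl : ∀ x ∈ X, ∀ y, G.Adj x y → y ∈ X) : ∃ c : G.ConnectedComponent, c.supp = X ∧
      Nonempty (c.toSimpleGraph ≃g completeBipartiteGraph (Fin 3) (Fin 3)) := by
  obtain ⟨x, y, z, p, q, r, P, hX, h1, h2, h3, h4, h5, h6⟩ := h
  have hs := exists_component_of_closed (v := x) (by simp [hX]) hcl (by
    intro u hu
    simp only [hX, Finset.mem_insert, Finset.mem_singleton] at hu
    rcases hu with rfl | rfl | rfl | rfl | rfl | rfl
    · exact Reachable.refl _
    · exact P.xp.reachable.trans P.yp.symm.reachable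
    · exact P.xp.reachable.trans P.zp.symm.reachable
    · exact P.xp.reachable
    · exact P.xq.reachable
    · exact P.xr.reachable)
  refine ⟨_, hs, nonempty_iso_completeBipartiteGraph ![x, y, z] ![p, q, r]
    (injective_vec_three P.ne_xy P.ne_xz P.ne_yz)
    (injective_vec_three P.ne_pq P.ne_pr P.ne_qr) ?_ ?_ ?_ ?_⟩
  · rw [hs, hX]
    ext u
    simp [eq_comm]
    tauto
  · simp [Fin.forall_fin_succ, h1, h2, h3, mt G.adj_symm h1, mt G.adj_symm h2, mt G.adj_symm h3]
  · simp [Fin.forall_fin_succ, h4, h5, h6, mt G.adj_symm h4, mt G.adj_symm h5, mt G.adj_symm h6]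
  · simp [Fin.forall_fin_succ, P.xp, P.xq, P.xr, P.yp, P.yq, P.yr, P.zp, P.zq, P.zr]

end
end SimpleGraph

open SimpleGraph in
theorem theorem2 {V : Type*} [Fintype V] (G : SimpleGraph V) [DecidableRel G.Adj]
    (hsubcubic : ∀ v : V, G.degree v ≤ 3)
    (hisolated : ∀ v : V, ¬ G.IsIsolated v) :
    ((Fintype.card V : ℝ)
        - (G.componentCount (completeBipartiteGraph (Fin 2) (Fin 3)) : ℝ)
        - (G.componentCount SimpleGraph.K4Plus : ℝ)
        - 2 * (G.componentCount (completeBipartiteGraph (Fin 3) (Fin 3)) : ℝ)) / 4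
      ≤ (G.acyclicMatchingNumber : ℝ) := by
  classical
  obtain ⟨S, -, hSf, hSm, 𝒳, h𝒳, hle⟩ := G.hasLargeMatching (fun U v =>
    (Finset.card_le_card fun u hu => by simpa using (mem_nbrIn.1 hu).2).trans (hsubcubic v))
    Finset.univ
  have hcl : ∀ X ∈ 𝒳, ∀ x ∈ X, ∀ y, G.Adj x y → y ∈ X := fun X hX x hx y hxy =>
    h𝒳.closed X hX x hx y (Finset.mem_univ y) hxy
  have h1 := card_le_two_mul_acyclicMatchingNumber hSf hSm
  have hK23 := card_le_componentCount (𝒳.filter G.InducesK23) fun X hX =>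
    (Finset.mem_filter.1 hX).2.exists_component (hcl X (Finset.mem_filter.1 hX).1)
  have hK4 := card_le_componentCount (𝒳.filter G.InducesK4Plus) fun X hX =>
    (Finset.mem_filter.1 hX).2.exists_component (hcl X (Finset.mem_filter.1 hX).1)
  have hK33 := card_le_componentCount (𝒳.filter G.InducesK33) fun X hX =>
    (Finset.mem_filter.1 hX).2.exists_component (hcl X (Finset.mem_filter.1 hX).1)
  have hloss : ∑ X ∈ 𝒳, G.loss X ≤ (𝒳.filter G.InducesK23).card +
      (𝒳.filter G.InducesK4Plus).card + 2 * (𝒳.filter G.InducesK33).card := by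
    simp only [Finset.card_filter, Finset.mul_sum]
    rw [← Finset.sum_add_distrib, ← Finset.sum_add_distrib]
    refine Finset.sum_le_sum fun X hX => ?_
    unfold loss
    rcases h𝒳.exceptional X hX with ⟨v, rfl⟩ | h | h | h
    -- A closed singleton is an isolated vertex, so this kind of loss does not occur for the whole
    -- graph.
    · refine absurd (fun w hvw => ?_) (hisolated v)
      have := hcl _ hX v (Finset.mem_singleton_self v) w hvw
      exact hvw.ne' (Finset.mem_singleton.1 this)
    · rw [if_pos h]
      split_ifs <;> omega
    · rw [if_pos h]
      split_ifs <;> omega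
    · rw [if_pos h]
      split_ifs <;> omega
  rw [Finset.card_univ] at hle
  have hfin : Fintype.card V ≤ 4 * G.acyclicMatchingNumber +
      G.componentCount (completeBipartiteGraph (Fin 2) (Fin 3)) + G.componentCount K4Plus +
      2 * G.componentCount (completeBipartiteGraph (Fin 3) (Fin 3)) := by omega
  have hfin' := (Nat.cast_le (α := ℝ)).2 hfin
  push_cast at hfin'
  linarith
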